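/- Identify Euclidean space $\mathbb{R}^3$ with $\mathbb{R}\times\mathbb{C}$ and let $h:\mathbb{C}^2\to\mathbb{R}\times\mathbb{C}$, $h(z,w)=\bigl((|z|^2-|w|^2)/2,\ z\overline{w}\bigr)$, be the Hopf map. For distinct points $P_1,\dots,P_n\in\mathbb{R}^3$ and $j<k$ choose a lift $v_{jk}=(z,w)\in\mathbb{C}^2$ of the vector $\overrightarrow{P_jP_k}$, i.e. $h(v_{jk})=\overrightarrow{P_jP_k}$, and put $v_{kj}=(-\overline{w},\overline{z})$, which is a lift of $\overrightarrow{P_kP_j}$. Let $C_k$ be the symmetric tensor product of the vectors $v_{kj}$, $j\ne k$; its coordinates are the coefficients of $1,X,\dots,X^{n-1}$ in the polynomial $\prod_{j\neq k}(z_{kj}+w_{kj}X)$, where $v_{kj}=(z_{kj},w_{kj})$. The Atiyah determinant $At(P_1,\dots,P_n)$ is the determinant of the $n\times n$ matrix with columns $C_1,\dots,C_n$; it does not depend on the choice of the lifts. (a) Let $P_1,P_2,P_3,P_4\in\mathbb{R}^3$ be four coplanar points which are the vertices (in any order) of a convex quadrilateral, i.e. none of them lies in the convex hull of the other three. Then $At(P_1,P_2,P_3,P_4)$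 is a real number and $$At(P_1,P_2,P_3,P_4)\ \ge\ \prod_{1\le j<k\le 4}2\,|P_jP_k| .$$ (b) Equivalently, for points $P_j=(0,z_j)$ of the plane $\{0\}\times\mathbb{C}$ as in (a), put $u_{jk}=(z_k-z_j)/|z_k-z_j|$ and let $At_{ang}$ be $\prod_{1\le j<k\le4}u_{jk}$ times the determinant of the $4\times4$ matrix whose $k$-th column consists of the elementary symmetric functions of degrees $0,1,2,3$ of the three numbers $\overline{u}_{kj}$, $j\neq k$. Then $$At(P_1,P_2,P_3,P_4)=\Bigl(\prod_{1\le j<k\le4}|z_k-z_j|\Bigr)\,At_{ang},$$ $At_{ang}$ is a real number, and $At_{ang}\ge 64$. -/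

import Mathlib

open scoped ComplexConjugate

noncomputable section

/-- Euclidean three-space, identified with `ℝ × ℂ` by the choice of an axis. -/
abbrev Space : Type := WithLp 2 (ℝ × ℂ)

/-- The Hopf map `h(z, w) = ((|z|² - |w|²) / 2, z * conj w)`. -/
def hopf (v : ℂ × ℂ) : Space :=
  WithLp.toLp 2 ((‖v.1‖ ^ 2 - ‖v.2‖ ^ 2) / 2, v.1 * conj v.2)

/-- Atiyah's normalization: a lift `(z, w)` of `V` gives the lift `(-conj w, conj z)` of `-V`. -/
def antipode (v : ℂ × ℂ) : ℂ × ℂ := (-conj v.2, conj v.1)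

/-- The lift `(d, conj z) / √d` of `V = (a, z)` under the Hopf map, where `d = a + ‖V‖`.
If `d = 0`, that is if `z = 0` and `a ≤ 0`, this is replaced by the lift `(0, √(2‖V‖))`. -/
def hopfLift (V : Space) : ℂ × ℂ :=
  if V.fst + ‖V‖ = 0 then (0, (Real.sqrt (2 * ‖V‖) : ℂ))
  else ((Real.sqrt (V.fst + ‖V‖) : ℂ), conj V.snd / (Real.sqrt (V.fst + ‖V‖) : ℂ))

/-- Given vectors `v j k` in `ℂ²`, the matrix whose `k`-th column is the symmetric tensor product
of the vectors `v k j`, `j ≠ k`. The coordinates of the symmetric tensor product of the vectors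
`(z_j, w_j)` are the coefficients of the polynomial `∏ (z_j + w_j X)`. -/
def symMatrix {n : ℕ} (v : Fin n → Fin n → ℂ × ℂ) : Matrix (Fin n) (Fin n) ℂ :=
  Matrix.of fun m k =>
    (∏ j ∈ Finset.univ.erase k,
      (Polynomial.C (v k j).1 + Polynomial.C (v k j).2 * Polynomial.X)).coeff (m : ℕ)

/-- `v j k` is a lift of the vector from `P j` to `P k`, with Atiyah's normalization: the lift for
`(k, j)` is determined by the lift for `(j, k)`, `j < k`. -/
structure IsLiftFamily {n : ℕ} (P : Fin n → Space) (v : Fin n → Fin n → ℂ × ℂ) : Prop where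
  hopf_eq : ∀ j k, j < k → hopf (v j k) = P k - P j
  antipode_eq : ∀ j k, j < k → v k j = antipode (v j k)

/-- The family of lifts that `hopfLift` gives. -/
def stdLifts {n : ℕ} (P : Fin n → Space) (j k : Fin n) : ℂ × ℂ :=
  if j < k then hopfLift (P k - P j) else antipode (hopfLift (P j - P k))

/-- The Atiyah determinant of `n` points in three-space. By `atiyahDet_eq_of_isLiftFamily` below
it does not depend on the choice of the lifts. -/
def atiyahDet {n : ℕ} (P : Fin n → Space) : ℂ := (symMatrix (stdLifts P)).det

/-- The point `(0, z)` of the plane `{0} × ℂ`. -/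
def planePoint (z : ℂ) : Space := WithLp.toLp 2 ((0 : ℝ), z)

/-- The direction `u_jk = (z_k - z_j) / |z_k - z_j|`. -/
def direction {n : ℕ} (z : Fin n → ℂ) (j k : Fin n) : ℂ := (z k - z j) / (‖z k - z j‖ : ℂ)

/-- The angular part of the Atiyah determinant of points in the plane: the product of the `u_jk`
over `j < k`, times the determinant whose `k`-th column consists of the elementary symmetric
functions (of degrees `0, …, n - 1`) of the `conj u_kj`, `j ≠ k`. -/
def angularPart {n : ℕ} (z : Fin n → ℂ) : ℂ :=
  (∏ j, ∏ k ∈ Finset.Ioi j, direction z j k) *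
    (symMatrix fun j k => (1, conj (direction z j k))).det

theorem hopf_hopfLift (V : Space) : hopf (hopfLift V) = V := by
  have hn : ‖V‖ ^ 2 = V.fst ^ 2 + ‖V.snd‖ ^ 2 := by
    rw [WithLp.prod_norm_sq_eq_of_L2]; simp
  have hz : 0 ≤ ‖V.snd‖ := norm_nonneg _
  have hV : 0 ≤ ‖V‖ := norm_nonneg _
  have hd : 0 ≤ V.fst + ‖V‖ := by nlinarith [sq_nonneg ‖V.snd‖]
  unfold hopfLift
  split_ifs with h
  · have h1 : V.fst = -‖V‖ := by linarith
    have h2 : ‖V.snd‖ = 0 := by nlinarith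
    have h3 : V.snd = 0 := norm_eq_zero.mp h2
    apply (WithLp.ofLp_injective 2)
    apply Prod.ext
    · change (‖(0 : ℂ)‖ ^ 2 - ‖((Real.sqrt (2 * ‖V‖) : ℝ) : ℂ)‖ ^ 2) / 2 = V.fst
      rw [Complex.norm_real, Real.norm_eq_abs, sq_abs, Real.sq_sqrt (by positivity)]
      rw [h1, norm_zero]; ring
    · change (0 : ℂ) * _ = V.snd
      rw [h3]; simp
  · have hpos : 0 < V.fst + ‖V‖ := lt_of_le_of_ne hd (Ne.symm h)
    have hs : 0 < Real.sqrt (V.fst + ‖V‖) := Real.sqrt_pos.mpr hpos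
    have hs2 := Real.sq_sqrt hd
    apply (WithLp.ofLp_injective 2)
    apply Prod.ext
    · change (‖((Real.sqrt (V.fst + ‖V‖) : ℝ) : ℂ)‖ ^ 2
        - ‖conj V.snd / ((Real.sqrt (V.fst + ‖V‖) : ℝ) : ℂ)‖ ^ 2) / 2 = V.fst
      rw [norm_div, RCLike.norm_conj, Complex.norm_real, Real.norm_eq_abs, div_pow, sq_abs, hs2]
      field_simp
      nlinarith
    · change ((Real.sqrt (V.fst + ‖V‖) : ℝ) : ℂ)
        * conj (conj V.snd / ((Real.sqrt (V.fst + ‖V‖) : ℝ) : ℂ)) = V.snd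
      have : ((Real.sqrt (V.fst + ‖V‖) : ℝ) : ℂ) ≠ 0 := by exact_mod_cast hs.ne'
      rw [map_div₀, Complex.conj_conj, Complex.conj_ofReal]
      field_simp

theorem isLiftFamily_stdLifts {n : ℕ} (P : Fin n → Space) : IsLiftFamily P (stdLifts P) where
  hopf_eq j k h := by simp [stdLifts, h, hopf_hopfLift]
  antipode_eq j k h := by simp [stdLifts, h, h.asymm]

/-- Two lifts of the same vector differ by a phase. -/
theorem exists_phase_of_hopf_eq {v w : ℂ × ℂ} (h : hopf v = hopf w) :
    ∃ c : ℂ, c * conj c = 1 ∧ w = (c * v.1, c * v.2) := by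
  have h' := congrArg WithLp.ofLp h
  have h1 : (‖v.1‖ ^ 2 - ‖v.2‖ ^ 2) / 2 = (‖w.1‖ ^ 2 - ‖w.2‖ ^ 2) / 2 := congrArg Prod.fst h'
  have h2 : v.1 * conj v.2 = w.1 * conj w.2 := congrArg Prod.snd h'
  have h3 : ‖v.1‖ * ‖v.2‖ = ‖w.1‖ * ‖w.2‖ := by
    simpa using congrArg (fun x : ℂ => ‖x‖) h2
  have h4 : (‖v.1‖ ^ 2 + ‖v.2‖ ^ 2) ^ 2 = (‖w.1‖ ^ 2 + ‖w.2‖ ^ 2) ^ 2 := by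
    have e1 : ‖v.1‖ ^ 2 - ‖v.2‖ ^ 2 = ‖w.1‖ ^ 2 - ‖w.2‖ ^ 2 := by linarith
    calc _ = (‖v.1‖ ^ 2 - ‖v.2‖ ^ 2) ^ 2 + 4 * (‖v.1‖ * ‖v.2‖) ^ 2 := by ring
      _ = _ := by rw [e1, h3]; ring
  have h5 : ‖v.1‖ ^ 2 + ‖v.2‖ ^ 2 = ‖w.1‖ ^ 2 + ‖w.2‖ ^ 2 :=
    (sq_eq_sq₀ (by positivity) (by positivity)).mp h4
  have n1 : ‖v.1‖ = ‖w.1‖ :=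
    (sq_eq_sq₀ (norm_nonneg _) (norm_nonneg _)).mp (by linarith)
  have n2 : ‖v.2‖ = ‖w.2‖ :=
    (sq_eq_sq₀ (norm_nonneg _) (norm_nonneg _)).mp (by linarith)
  have unit : ∀ a b : ℂ, a ≠ 0 → ‖a‖ = ‖b‖ → (b / a) * conj (b / a) = 1 := by
    intro a b ha hab
    rw [Complex.mul_conj', norm_div, hab, div_self (by rw [← hab]; exact norm_ne_zero_iff.mpr ha)]
    simp
  by_cases hv : v.1 = 0
  · have hw : w.1 = 0 := by rw [← norm_eq_zero, ← n1, hv, norm_zero]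
    by_cases hv2 : v.2 = 0
    · have hw2 : w.2 = 0 := by rw [← norm_eq_zero, ← n2, hv2, norm_zero]
      exact ⟨1, by simp, by rw [hv, hv2]; exact Prod.ext (by simp [hw]) (by simp [hw2])⟩
    · exact ⟨w.2 / v.2, unit _ _ hv2 n2, Prod.ext (by simp [hw, hv]) (by simp [hv2])⟩
  · refine ⟨w.1 / v.1, unit _ _ hv n1, Prod.ext (by simp [hv]) ?_⟩
    have hw : w.1 ≠ 0 := by rw [← norm_ne_zero_iff, ← n1]; exact norm_ne_zero_iff.mpr hv
    have e : conj v.1 * v.2 = conj w.1 * w.2 := by simpa using congrArg conj h2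
    have q : v.1 * conj v.1 = w.1 * conj w.1 := by
      rw [Complex.mul_conj', Complex.mul_conj', n1]
    have hcw : conj w.1 ≠ 0 := by simpa using hw
    change w.2 = w.1 / v.1 * v.2
    field_simp
    apply mul_left_cancel₀ hcw
    linear_combination v.2 * q - v.1 * e

/-- The Atiyah determinant may be computed with any normalized family of lifts. -/
theorem atiyahDet_eq_of_isLiftFamily {n : ℕ} {P : Fin n → Space} {v : Fin n → Fin n → ℂ × ℂ}
    (hv : IsLiftFamily P v) : (symMatrix v).det = atiyahDet P := by
  have hs := isLiftFamily_stdLifts P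
  have key : ∀ j k : Fin n, ∃ c : ℂ, j < k →
      c * conj c = 1 ∧ v j k = (c * (stdLifts P j k).1, c * (stdLifts P j k).2) := by
    intro j k
    by_cases h : j < k
    · obtain ⟨c, hc⟩ := exists_phase_of_hopf_eq
        ((hs.hopf_eq j k h).trans (hv.hopf_eq j k h).symm)
      exact ⟨c, fun _ => hc⟩
    · exact ⟨1, fun h' => absurd h' h⟩
  choose c hc using key
  let e : Fin n → Fin n → ℂ := fun j k => if j < k then c j k else if k < j then conj (c k j) else 1
  have he : ∀ j k, k ≠ j → v j k = (e j k * (stdLifts P j k).1, e j k * (stdLifts P j k).2) := by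
    intro j k hjk
    rcases lt_or_gt_of_ne hjk with h | h
    · have h0 := (hc k j h).2
      rw [hv.antipode_eq k j h, hs.antipode_eq k j h, h0]
      simp [e, h, h.asymm, antipode]
    · simpa [e, h] using (hc j k h).2
  have hprod : ∏ k, ∏ j ∈ Finset.univ.erase k, e k j = 1 := by
    have hdiag : ∀ k, ∏ j ∈ Finset.univ.erase k, e k j = ∏ j, e k j := by
      intro k
      rw [← Finset.mul_prod_erase Finset.univ (e k) (Finset.mem_univ k)]
      simp [e]
    have hsplit : ∀ k j, e k j = (if k < j then c k j else 1) * (if j < k then conj (c j k) else 1) := by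
      intro k j
      rcases lt_trichotomy k j with h | h | h
      · simp [e, h, h.asymm]
      · simp [e, h]
      · simp [e, h, h.asymm]
    simp_rw [hdiag, hsplit, Finset.prod_mul_distrib]
    rw [Finset.prod_comm (f := fun k j => if j < k then conj (c j k) else 1)]
    rw [← Finset.prod_mul_distrib]
    refine Finset.prod_eq_one fun k _ => ?_
    rw [← Finset.prod_mul_distrib]
    refine Finset.prod_eq_one fun j _ => ?_
    by_cases h : k < j
    · simpa [h] using (hc k j h).1
    · simp [h]
  have hM : symMatrix v =
      Matrix.of fun m k => (∏ j ∈ Finset.univ.erase k, e k j) * symMatrix (stdLifts P) m k := by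
    ext m k
    simp only [symMatrix, Matrix.of_apply]
    rw [← Polynomial.coeff_C_mul, map_prod, ← Finset.prod_mul_distrib]
    congr 1
    refine Finset.prod_congr rfl fun j hj => ?_
    rw [he k j (Finset.ne_of_mem_erase hj)]
    simp only [map_mul]
    ring
  rw [hM, Matrix.det_mul_row, hprod, one_mul, atiyahDet]

end

/-! The group `SU(2)` acts on the lifts and, through the Hopf map, by rotations on three-space. It
preserves the determinant, so coplanar points may be moved into `{0} × ℂ` (`exists_plane_model`).
There the lifts are `√r (1, conj u)` up to a phase, the distances split off, and `angularPart`
remains (`atiyahDet_planePoint`).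

Expanding `angularPart` in the six directions (`angularPart_eq`) gives `64 - 8 (K - 1) + 4 ∑ t_v
s_v`. Here `t_v` is the cosine sum, minus one, of the triangle omitting the vertex `v`; `s_v` is
three plus the cosines of the three angles at `v`; and `K` is the sum of the three cosines
`oppositeAngleCos`. It remains to show `2 (K - 1) ≤ ∑ t_v s_v`.

The diagonals cut the quadrilateral into four triangles, with base angles `x_i`, `y_i` in cyclic
order. Let `A = x₁ + y₄` and `C = y₂ + x₃` be two opposite angles, `α = y₁ - x₃` and `γ = x₂ - y₄`.
Then `α + γ + (A + C) = π`, so `K - 1 = 4 sin(α/2) sin(γ/2) sin((A+C)/2)`. The law of sines around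
the crossing point forces `α` and `γ` to have compatible signs, and a cyclic relabelling makes both
nonnegative. All `t_v` are nonnegative and all `s_v` are at least 2, so two opposite terms suffice:
their `t_v` are `4 sin(A/2) sin(y₁/2) sin(x₄/2)` and `4 sin(C/2) sin(y₃/2) sin(x₂/2)`. Replacing
`y₁, y₃` by the smaller `α` and `x₄, x₂` by the smaller `γ`, and using subadditivity of the sine,
bounds their sum below by `K - 1`. -/

/-! ### Trigonometric inequalities for a quadrilateral -/

theorem cos_add_cos_add_cos_sub_one {A B C : ℝ} (h : A + B + C = Real.pi) :
    Real.cos A + Real.cos B + Real.cos C - 1 =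
      4 * (Real.sin (A / 2) * Real.sin (B / 2) * Real.sin (C / 2)) := by
  have e1 : Real.cos A + Real.cos B = 2 * Real.cos ((A + B) / 2) * Real.cos ((A - B) / 2) :=
    Real.cos_add_cos A B
  have e2 : Real.cos ((A + B) / 2) = Real.sin (C / 2) := by
    rw [← Real.cos_pi_div_two_sub]; congr 1; linarith
  have e3 : Real.cos C = 1 - 2 * Real.sin (C / 2) ^ 2 := by
    have := Real.cos_sq' (C / 2)
    have h2 := Real.cos_two_mul (C / 2)
    rw [mul_div_cancel₀ C two_ne_zero] at h2
    linarith
  have e4 : Real.cos ((A - B) / 2) - Real.cos ((A + B) / 2) =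
      2 * (Real.sin (A / 2) * Real.sin (B / 2)) := by
    rw [sub_div, add_div, Real.cos_sub, Real.cos_add]; ring
  rw [e1, e3]
  linear_combination (2 * Real.sin (C / 2)) * e4 + (2 * Real.cos ((A - B) / 2)
    + 2 * Real.sin (C / 2)) * e2

theorem sin_half_nonneg {x : ℝ} (h0 : 0 ≤ x) (h1 : x ≤ Real.pi) : 0 ≤ Real.sin (x / 2) :=
  Real.sin_nonneg_of_nonneg_of_le_pi (by linarith) (by linarith)

theorem sin_half_mono {x y : ℝ} (h0 : 0 ≤ x) (h : x ≤ y) (h1 : y ≤ Real.pi) :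
    Real.sin (x / 2) ≤ Real.sin (y / 2) :=
  Real.sin_le_sin_of_le_of_le_pi_div_two (by linarith) (by linarith) (by linarith)

theorem cos_add_cos_add_cos_sub_one_nonneg {A B C : ℝ} (h : A + B + C = Real.pi)
    (hA : 0 ≤ A) (hB : 0 ≤ B) (hC : 0 ≤ C) :
    0 ≤ Real.cos A + Real.cos B + Real.cos C - 1 := by
  rw [cos_add_cos_add_cos_sub_one h]
  have := sin_half_nonneg hA (by linarith)
  have := sin_half_nonneg hB (by linarith)
  have := sin_half_nonneg hC (by linarith)
  positivity

/-- With `c = cos((x+y)/2)` and `c' = cos((x-y)/2)` the right side is `2 + 2c² + 2cc'`, and both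
cosines are nonnegative in this range. -/
theorem two_le_three_add_cos {x y : ℝ} (hx : 0 ≤ x) (hy : 0 ≤ y) (h : x + y ≤ Real.pi) :
    2 ≤ 3 + Real.cos x + Real.cos y + Real.cos (x + y) := by
  have e1 : Real.cos x + Real.cos y = 2 * Real.cos ((x + y) / 2) * Real.cos ((x - y) / 2) :=
    Real.cos_add_cos x y
  have e2 : Real.cos (x + y) = 2 * Real.cos ((x + y) / 2) ^ 2 - 1 := by
    rw [← Real.cos_two_mul]; congr 1; ring
  have c1 : 0 ≤ Real.cos ((x + y) / 2) :=
    Real.cos_nonneg_of_neg_pi_div_two_le_of_le (by linarith) (by linarith)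
  have c2 : 0 ≤ Real.cos ((x - y) / 2) :=
    Real.cos_nonneg_of_neg_pi_div_two_le_of_le (by linarith) (by linarith)
  have := mul_nonneg c1 c2
  rw [e2]
  nlinarith [sq_nonneg (Real.cos ((x + y) / 2))]

theorem sin_add_le_sin_add_sin {x y : ℝ} (hx : 0 ≤ x) (hy : 0 ≤ y) (hx' : x ≤ Real.pi)
    (hy' : y ≤ Real.pi) : Real.sin (x + y) ≤ Real.sin x + Real.sin y := by
  rw [Real.sin_add]
  have := Real.sin_nonneg_of_nonneg_of_le_pi hx hx'
  have := Real.sin_nonneg_of_nonneg_of_le_pi hy hy'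
  nlinarith [Real.cos_le_one x, Real.cos_le_one y]

/-- The trigonometric form of the inequality for a convex quadrilateral, if the opposite angles
`x₁ + y₄` and `y₂ + x₃` have a sum of at most `π`. -/
theorem quadrilateral_cos_le_of_le {θ x₁ y₁ x₂ y₂ x₃ y₃ x₄ y₄ : ℝ}
    (p₁ : 0 ≤ x₁) (q₁ : 0 ≤ y₁) (p₂ : 0 ≤ x₂) (q₂ : 0 ≤ y₂) (p₃ : 0 ≤ x₃) (q₃ : 0 ≤ y₃)
    (p₄ : 0 ≤ x₄) (q₄ : 0 ≤ y₄) (h₁ : x₁ + y₁ = Real.pi - θ) (h₂ : x₂ + y₂ = θ)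
    (h₃ : x₃ + y₃ = Real.pi - θ) (h₄ : x₄ + y₄ = θ) (hα : x₃ ≤ y₁) (hγ : y₄ ≤ x₂) :
    2 * (Real.cos (y₁ - x₃) + Real.cos (x₂ - y₄) + Real.cos (x₁ + y₄ + (y₂ + x₃)) - 1) ≤
      (Real.cos (x₁ + y₄) + Real.cos y₁ + Real.cos x₄ - 1) *
          (3 + Real.cos y₂ + Real.cos x₃ + Real.cos (y₂ + x₃)) +
        (Real.cos (y₂ + x₃) + Real.cos y₃ + Real.cos x₂ - 1) *
          (3 + Real.cos x₁ + Real.cos y₄ + Real.cos (x₁ + y₄)) +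
        (Real.cos (y₁ + x₂) + Real.cos x₁ + Real.cos y₂ - 1) *
          (3 + Real.cos y₃ + Real.cos x₄ + Real.cos (y₃ + x₄)) +
        (Real.cos (y₃ + x₄) + Real.cos x₃ + Real.cos y₄ - 1) *
          (3 + Real.cos y₁ + Real.cos x₂ + Real.cos (y₁ + x₂)) := by
  have tC := cos_add_cos_add_cos_sub_one_nonneg (A := y₁ + x₂) (B := x₁) (C := y₂)
    (by linarith) (by linarith) p₁ q₂
  have tD := cos_add_cos_add_cos_sub_one_nonneg (A := y₃ + x₄) (B := x₃) (C := y₄)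
    (by linarith) (by linarith) p₃ q₄
  have tA := cos_add_cos_add_cos_sub_one_nonneg (A := x₁ + y₄) (B := y₁) (C := x₄)
    (by linarith) (by linarith) q₁ p₄
  have tB := cos_add_cos_add_cos_sub_one_nonneg (A := y₂ + x₃) (B := y₃) (C := x₂)
    (by linarith) (by linarith) q₃ p₂
  have sA := two_le_three_add_cos q₂ p₃ (by linarith)
  have sB := two_le_three_add_cos p₁ q₄ (by linarith)
  have sC := two_le_three_add_cos q₃ p₄ (by linarith)
  have sD := two_le_three_add_cos q₁ p₂ (by linarith)
  have key : Real.cos (y₁ - x₃) + Real.cos (x₂ - y₄) + Real.cos (x₁ + y₄ + (y₂ + x₃)) - 1 ≤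
      (Real.cos (x₁ + y₄) + Real.cos y₁ + Real.cos x₄ - 1) +
        (Real.cos (y₂ + x₃) + Real.cos y₃ + Real.cos x₂ - 1) := by
    -- All three triples have sum `π`; the last consists of `α`, `γ` and `A + C`.
    rw [cos_add_cos_add_cos_sub_one (A := x₁ + y₄) (by linarith),
      cos_add_cos_add_cos_sub_one (A := y₂ + x₃) (by linarith),
      cos_add_cos_add_cos_sub_one (A := y₁ - x₃) (by linarith)]
    have a0 := sin_half_nonneg (x := y₁ - x₃) (by linarith) (by linarith)
    have g0 := sin_half_nonneg (x := x₂ - y₄) (by linarith) (by linarith)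
    have A0 := sin_half_nonneg (x := x₁ + y₄) (by linarith) (by linarith)
    have C0 := sin_half_nonneg (x := y₂ + x₃) (by linarith) (by linarith)
    have a1 := sin_half_mono (x := y₁ - x₃) (y := y₁) (by linarith) (by linarith) (by linarith)
    have a2 := sin_half_mono (x := y₁ - x₃) (y := y₃) (by linarith) (by linarith) (by linarith)
    have g1 := sin_half_mono (x := x₂ - y₄) (y := x₄) (by linarith) (by linarith) (by linarith)
    have g2 := sin_half_mono (x := x₂ - y₄) (y := x₂) (by linarith) (by linarith) (by linarith)
    have b := sin_add_le_sin_add_sin (x := (x₁ + y₄) / 2) (y := (y₂ + x₃) / 2) (by linarith)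
      (by linarith) (by linarith) (by linarith)
    rw [← add_div] at b
    have m1 := mul_le_mul_of_nonneg_left (mul_le_mul a1 g1 g0 (a0.trans a1)) A0
    have m2 := mul_le_mul_of_nonneg_left (mul_le_mul a2 g2 g0 (a0.trans a2)) C0
    have m3 := mul_le_mul_of_nonneg_left b (mul_nonneg a0 g0)
    linarith
  -- Of the four products only the two treated in `key` are needed; the other two are just
  -- nonnegative.
  have := mul_le_mul_of_nonneg_left sA tA
  have := mul_le_mul_of_nonneg_left sB tB
  have := mul_nonneg tC (by linarith : 0 ≤ 3 + Real.cos y₃ + Real.cos x₄ + Real.cos (y₃ + x₄))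
  have := mul_nonneg tD (by linarith : 0 ≤ 3 + Real.cos y₁ + Real.cos x₂ + Real.cos (y₁ + x₂))
  linarith

/-- The sine relation `hs` excludes opposite signs of `y₁ - x₃` and `x₂ - y₄`: by `eα` and `eγ`
these signs decide how `sin x₁ sin x₃` compares with `sin y₁ sin y₃`, and `sin x₂ sin x₄` with `sin
y₂ sin y₄`. -/
theorem quadrilateral_cos_le {θ x₁ y₁ x₂ y₂ x₃ y₃ x₄ y₄ : ℝ}
    (p₁ : 0 < x₁) (q₁ : 0 < y₁) (p₂ : 0 < x₂) (q₂ : 0 < y₂) (p₃ : 0 < x₃) (q₃ : 0 < y₃)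
    (p₄ : 0 < x₄) (q₄ : 0 < y₄) (h₁ : x₁ + y₁ = Real.pi - θ) (h₂ : x₂ + y₂ = θ)
    (h₃ : x₃ + y₃ = Real.pi - θ) (h₄ : x₄ + y₄ = θ)
    (hs : Real.sin x₁ * Real.sin x₃ * (Real.sin x₂ * Real.sin x₄) =
      Real.sin y₁ * Real.sin y₃ * (Real.sin y₂ * Real.sin y₄)) :
    2 * (Real.cos (y₁ - x₃) + Real.cos (x₂ - y₄) + Real.cos (x₁ + y₄ + (y₂ + x₃)) - 1) ≤
      (Real.cos (x₁ + y₄) + Real.cos y₁ + Real.cos x₄ - 1) *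
          (3 + Real.cos y₂ + Real.cos x₃ + Real.cos (y₂ + x₃)) +
        (Real.cos (y₂ + x₃) + Real.cos y₃ + Real.cos x₂ - 1) *
          (3 + Real.cos x₁ + Real.cos y₄ + Real.cos (x₁ + y₄)) +
        (Real.cos (y₁ + x₂) + Real.cos x₁ + Real.cos y₂ - 1) *
          (3 + Real.cos y₃ + Real.cos x₄ + Real.cos (y₃ + x₄)) +
        (Real.cos (y₃ + x₄) + Real.cos x₃ + Real.cos y₄ - 1) *
          (3 + Real.cos y₁ + Real.cos x₂ + Real.cos (y₁ + x₂)) := by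
  have sinpos : ∀ x : ℝ, 0 < x → x < Real.pi → 0 < Real.sin x :=
    fun x => Real.sin_pos_of_pos_of_lt_pi
  have s1 := sinpos x₁ p₁ (by linarith)
  have s2 := sinpos x₂ p₂ (by linarith)
  have s3 := sinpos x₃ p₃ (by linarith)
  have s4 := sinpos x₄ p₄ (by linarith)
  have r1 := sinpos y₁ q₁ (by linarith)
  have r2 := sinpos y₂ q₂ (by linarith)
  have r3 := sinpos y₃ q₃ (by linarith)
  have r4 := sinpos y₄ q₄ (by linarith)
  have sθ := sinpos θ (by linarith) (by linarith)
  have product : ∀ x y : ℝ, Real.sin x * Real.sin y =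
      (Real.cos (x - y) - Real.cos (x + y)) / 2 := by
    intro x y; rw [Real.cos_sub, Real.cos_add]; ring
  have eα : Real.sin y₁ * Real.sin y₃ - Real.sin x₁ * Real.sin x₃ =
      Real.sin θ * Real.sin (y₁ - x₃) := by
    have e1 : y₁ - y₃ = -(x₁ - x₃) := by linarith
    have e2 : y₁ + y₃ = Real.pi - (θ - (y₁ - x₃)) := by linarith
    have e3 : x₁ + x₃ = Real.pi - (θ + (y₁ - x₃)) := by linarith
    rw [product, product, product, e1, e2, e3, Real.cos_neg, Real.cos_pi_sub, Real.cos_pi_sub]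
    ring
  have eγ : Real.sin x₂ * Real.sin x₄ - Real.sin y₂ * Real.sin y₄ =
      Real.sin θ * Real.sin (x₂ - y₄) := by
    have e1 : x₂ - x₄ = -(y₂ - y₄) := by linarith
    have e2 : x₂ + x₄ = θ + (x₂ - y₄) := by linarith
    have e3 : y₂ + y₄ = θ - (x₂ - y₄) := by linarith
    rw [product, product, product, e1, e2, e3, Real.cos_neg]
    ring
  rcases le_or_gt x₃ y₁ with hα | hα
  · refine quadrilateral_cos_le_of_le p₁.le q₁.le p₂.le q₂.le p₃.le q₃.le p₄.le q₄.le h₁ h₂ h₃ h₄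
      hα ?_
    by_contra! hγ
    have n1 : Real.sin (x₂ - y₄) < 0 :=
      Real.sin_neg_of_neg_of_neg_pi_lt (by linarith) (by linarith)
    have n2 : 0 ≤ Real.sin (y₁ - x₃) :=
      Real.sin_nonneg_of_nonneg_of_le_pi (by linarith) (by linarith)
    have m1 : Real.sin x₂ * Real.sin x₄ < Real.sin y₂ * Real.sin y₄ := by nlinarith
    have m2 : Real.sin x₁ * Real.sin x₃ ≤ Real.sin y₁ * Real.sin y₃ := by nlinarith
    exact hs.not_lt (mul_lt_mul' m2 m1 (by positivity) (by positivity))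
  · have hγ : x₂ ≤ y₄ := by
      by_contra! hγ
      have n1 : 0 < Real.sin (x₂ - y₄) := sinpos _ (by linarith) (by linarith)
      have n2 : Real.sin (y₁ - x₃) < 0 :=
        Real.sin_neg_of_neg_of_neg_pi_lt (by linarith) (by linarith)
      have m1 : Real.sin y₂ * Real.sin y₄ < Real.sin x₂ * Real.sin x₄ := by nlinarith
      have m2 : Real.sin y₁ * Real.sin y₃ < Real.sin x₁ * Real.sin x₃ := by nlinarith
      exact hs.not_gt (mul_lt_mul' m2.le m1 (by positivity) (by positivity))
    -- Shifting the vertices by one place exchanges `θ` with `π - θ` and reverses both signs.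
    have := quadrilateral_cos_le_of_le (θ := Real.pi - θ) p₂.le q₂.le p₃.le q₃.le p₄.le q₄.le
      p₁.le q₁.le (by linarith) h₃ (by linarith) h₁ (by linarith) (by linarith)
    have e1 : Real.cos (y₂ - x₄) = Real.cos (x₂ - y₄) := by
      rw [← Real.cos_neg]; congr 1; linarith
    have e2 : Real.cos (x₃ - y₁) = Real.cos (y₁ - x₃) := by
      rw [← Real.cos_neg]; congr 1; linarith
    have e3 : Real.cos (x₂ + y₁ + (y₃ + x₄)) = Real.cos (x₁ + y₄ + (y₂ + x₃)) := by
      rw [← Real.cos_neg, ← Real.cos_add_two_pi]; congr 1; linarith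
    rw [e1, e2, e3, add_comm x₂ y₁, add_comm y₄ x₁] at this
    linarith

/-! ### The angular part as a polynomial in cosines -/

/-- The cosine of the angle at the `j`-th point between the `k`-th and the `l`-th point. -/
noncomputable def angleCos {n : ℕ} (z : Fin n → ℂ) (j k l : Fin n) : ℝ :=
  (direction z j k * conj (direction z j l)).re

/-- The cosine of the sum of the oriented angles `kjm` and `mlk`. -/
noncomputable def oppositeAngleCos {n : ℕ} (z : Fin n → ℂ) (j k l m : Fin n) : ℝ :=
  (direction z j k * conj (direction z j m) * (direction z l m * conj (direction z l k))).re

theorem direction_swap {n : ℕ} (z : Fin n → ℂ) (j k : Fin n) :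
    direction z k j = -direction z j k := by
  rw [direction, direction, ← neg_sub (z k) (z j), norm_neg, neg_div]

theorem norm_direction {n : ℕ} {z : Fin n → ℂ} {j k : Fin n} (h : z j ≠ z k) :
    ‖direction z j k‖ = 1 := by
  have : ‖z k - z j‖ ≠ 0 := norm_ne_zero_iff.mpr (sub_ne_zero.mpr h.symm)
  rw [direction, norm_div, Complex.norm_real, norm_norm, div_self this]

theorem prod_linear_coeff (a b : Fin 3 → ℂ) :
    let p := (Polynomial.C (a 0) + Polynomial.C (b 0) * Polynomial.X) *
      ((Polynomial.C (a 1) + Polynomial.C (b 1) * Polynomial.X) *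
      (Polynomial.C (a 2) + Polynomial.C (b 2) * Polynomial.X))
    p.coeff 0 = a 0 * a 1 * a 2 ∧
    p.coeff 1 = a 0 * a 1 * b 2 + a 0 * b 1 * a 2 + b 0 * a 1 * a 2 ∧
    p.coeff 2 = a 0 * b 1 * b 2 + b 0 * a 1 * b 2 + b 0 * b 1 * a 2 ∧
    p.coeff 3 = b 0 * b 1 * b 2 := by
  intro p
  have hp : p = Polynomial.C (a 0 * a 1 * a 2) +
      Polynomial.C (a 0 * a 1 * b 2 + a 0 * b 1 * a 2 + b 0 * a 1 * a 2) * Polynomial.X +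
      Polynomial.C (a 0 * b 1 * b 2 + b 0 * a 1 * b 2 + b 0 * b 1 * a 2) * Polynomial.X ^ 2 +
      Polynomial.C (b 0 * b 1 * b 2) * Polynomial.X ^ 3 := by
    simp only [p, map_mul, map_add]; ring
  rw [hp]
  refine ⟨?_, ?_, ?_, ?_⟩ <;>
    simp only [Polynomial.coeff_add, Polynomial.coeff_C_mul, Polynomial.coeff_C,
      Polynomial.coeff_X, Polynomial.coeff_X_pow] <;> norm_num

/-- The coefficients of `(a₀ + b₀ X) (a₁ + b₁ X) (a₂ + b₂ X)`. -/
def cubicCoeff (u v w : ℂ × ℂ) : Fin 4 → ℂ :=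
  ![u.1 * v.1 * w.1, u.1 * v.1 * w.2 + u.1 * v.2 * w.1 + u.2 * v.1 * w.1,
    u.1 * v.2 * w.2 + u.2 * v.1 * w.2 + u.2 * v.2 * w.1, u.2 * v.2 * w.2]

theorem symMatrix_four (v : Fin 4 → Fin 4 → ℂ × ℂ) :
    symMatrix v = Matrix.of fun m k =>
      ![cubicCoeff (v 0 1) (v 0 2) (v 0 3), cubicCoeff (v 1 0) (v 1 2) (v 1 3),
        cubicCoeff (v 2 0) (v 2 1) (v 2 3), cubicCoeff (v 3 0) (v 3 1) (v 3 2)] k m := by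
  have e0 : (Finset.univ.erase 0 : Finset (Fin 4)) = {1, 2, 3} := by decide
  have e1 : (Finset.univ.erase 1 : Finset (Fin 4)) = {0, 2, 3} := by decide
  have e2 : (Finset.univ.erase 2 : Finset (Fin 4)) = {0, 1, 3} := by decide
  have e3 : (Finset.univ.erase 3 : Finset (Fin 4)) = {0, 1, 2} := by decide
  have key : ∀ (s t r : ℂ × ℂ) (m : Fin 4), ((Polynomial.C s.1 + Polynomial.C s.2 * Polynomial.X) *
      ((Polynomial.C t.1 + Polynomial.C t.2 * Polynomial.X) *
      (Polynomial.C r.1 + Polynomial.C r.2 * Polynomial.X))).coeff (m : ℕ) = cubicCoeff s t r m := by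
    intro s t r m
    obtain ⟨h0, h1, h2, h3⟩ := prod_linear_coeff ![s.1, t.1, r.1] ![s.2, t.2, r.2]
    fin_cases m
    · exact h0
    · exact h1
    · exact h2
    · exact h3
  ext m k
  fin_cases k
  · simp [symMatrix, e0, ← key]
  · simp [symMatrix, e1, ← key]
  · simp [symMatrix, e2, ← key]
  · simp [symMatrix, e3, ← key]

/-- The cosine of the angle between two complex numbers of modulus one. -/
noncomputable def unitCos (x y : ℂ) : ℂ := (x * y⁻¹ + x⁻¹ * y) / 2

theorem det_fin_four (M : Matrix (Fin 4) (Fin 4) ℂ) : M.det =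
    M 0 0 * (M 1 1 * (M 2 2 * M 3 3 - M 2 3 * M 3 2) - M 1 2 * (M 2 1 * M 3 3 - M 2 3 * M 3 1)
      + M 1 3 * (M 2 1 * M 3 2 - M 2 2 * M 3 1))
    - M 0 1 * (M 1 0 * (M 2 2 * M 3 3 - M 2 3 * M 3 2) - M 1 2 * (M 2 0 * M 3 3 - M 2 3 * M 3 0)
      + M 1 3 * (M 2 0 * M 3 2 - M 2 2 * M 3 0))
    + M 0 2 * (M 1 0 * (M 2 1 * M 3 3 - M 2 3 * M 3 1) - M 1 1 * (M 2 0 * M 3 3 - M 2 3 * M 3 0)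
      + M 1 3 * (M 2 0 * M 3 1 - M 2 1 * M 3 0))
    - M 0 3 * (M 1 0 * (M 2 1 * M 3 2 - M 2 2 * M 3 1) - M 1 1 * (M 2 0 * M 3 2 - M 2 2 * M 3 0)
      + M 1 2 * (M 2 0 * M 3 1 - M 2 1 * M 3 0)) := by
  have s : ∀ j k l : Fin 4, (Matrix.of fun a b : Fin 3 => M (Fin.succ a) (![j, k, l] b)).det =
      M 1 j * (M 2 k * M 3 l - M 2 l * M 3 k) - M 1 k * (M 2 j * M 3 l - M 2 l * M 3 j)
      + M 1 l * (M 2 j * M 3 k - M 2 k * M 3 j) := by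
    intro j k l
    rw [Matrix.det_fin_three]
    simp only [Matrix.of_apply, Matrix.cons_val]
    change M 1 j * M 2 k * M 3 l - M 1 j * M 2 l * M 3 k - M 1 k * M 2 j * M 3 l
      + M 1 k * M 2 l * M 3 j + M 1 l * M 2 j * M 3 k - M 1 l * M 2 k * M 3 j = _
    ring
  rw [← s 1 2 3, ← s 0 2 3, ← s 0 1 3, ← s 0 1 2, Matrix.det_succ_row_zero, Fin.sum_univ_four]
  have t : ∀ i : Fin 4, ∀ j k l, Fin.succAbove i = ![j, k, l] →
      M.submatrix Fin.succ i.succAbove =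
        Matrix.of fun a b : Fin 3 => M (Fin.succ a) (![j, k, l] b) := by
    intro i j k l h; ext a b; simp [h]
  rw [t 0 1 2 3 (by decide), t 1 0 2 3 (by decide), t 2 0 1 3 (by decide), t 3 0 1 2 (by decide)]
  norm_num
  ring

/-- On the unit circle conjugation is inversion, so the expansion is an identity of Laurent
polynomials. The six directions enter as independent variables; that they come from four points
plays no role. -/
theorem det_cubicCoeff_units {a b c d e f : ℂ} (ha : a ≠ 0) (hb : b ≠ 0) (hc : c ≠ 0)
    (hd : d ≠ 0) (he : e ≠ 0) (hf : f ≠ 0) :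
    a * b * c * d * e * f * (Matrix.of fun m k =>
      ![cubicCoeff (1, a⁻¹) (1, b⁻¹) (1, c⁻¹), cubicCoeff (1, -a⁻¹) (1, d⁻¹) (1, e⁻¹),
        cubicCoeff (1, -b⁻¹) (1, -d⁻¹) (1, f⁻¹),
        cubicCoeff (1, -c⁻¹) (1, -e⁻¹) (1, -f⁻¹)] k m : Matrix (Fin 4) (Fin 4) ℂ).det =
    64 - 8 * (unitCos (a * f) (b * e) + unitCos (b * e) (c * d) - unitCos (a * f) (c * d) - 1)
      + 4 * ((unitCos d e - unitCos d f + unitCos e f - 1)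
          * (3 + unitCos a b + unitCos a c + unitCos b c)
        + (unitCos b c - unitCos b f + unitCos c f - 1)
          * (3 - unitCos a d - unitCos a e + unitCos d e)
        + (unitCos a c - unitCos a e + unitCos c e - 1)
          * (3 + unitCos b d - unitCos b f - unitCos d f)
        + (unitCos a b - unitCos a d + unitCos b d - 1)
          * (3 + unitCos c e + unitCos c f + unitCos e f)) := by
  rw [det_fin_four]
  simp only [cubicCoeff, Matrix.of_apply, Matrix.cons_val, unitCos]
  field_simp
  ring

theorem conj_eq_inv_of_norm_eq_one {w : ℂ} (h : ‖w‖ = 1) : conj w = w⁻¹ := by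
  rw [Complex.inv_def, Complex.normSq_eq_norm_sq, h]; simp

theorem ofReal_re_mul_conj {x y : ℂ} (hx : ‖x‖ = 1) (hy : ‖y‖ = 1) :
    (((x * conj y).re : ℝ) : ℂ) = unitCos x y := by
  rw [Complex.re_eq_add_conj, map_mul, Complex.conj_conj, unitCos, conj_eq_inv_of_norm_eq_one hx,
    conj_eq_inv_of_norm_eq_one hy]

theorem unitCos_neg_left (x y : ℂ) : unitCos (-x) y = -unitCos x y := by
  rw [unitCos, unitCos, inv_neg]; ring

theorem unitCos_neg_right (x y : ℂ) : unitCos x (-y) = -unitCos x y := by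
  rw [unitCos, unitCos, inv_neg]; ring

/-- The planar case of the formula of Eastwood and Norbury. -/
theorem angularPart_eq {z : Fin 4 → ℂ} (hz : Function.Injective z) :
    angularPart z = ((64
      - 8 * (oppositeAngleCos z 0 1 2 3 + oppositeAngleCos z 0 2 1 3 + oppositeAngleCos z 0 1 3 2
        - 1)
      + 4 * ((angleCos z 1 2 3 + angleCos z 2 1 3 + angleCos z 3 1 2 - 1)
          * (3 + angleCos z 0 1 2 + angleCos z 0 1 3 + angleCos z 0 2 3)
        + (angleCos z 0 2 3 + angleCos z 2 0 3 + angleCos z 3 0 2 - 1)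
          * (3 + angleCos z 1 0 2 + angleCos z 1 0 3 + angleCos z 1 2 3)
        + (angleCos z 0 1 3 + angleCos z 1 0 3 + angleCos z 3 0 1 - 1)
          * (3 + angleCos z 2 0 1 + angleCos z 2 0 3 + angleCos z 2 1 3)
        + (angleCos z 0 1 2 + angleCos z 1 0 2 + angleCos z 2 0 1 - 1)
          * (3 + angleCos z 3 0 1 + angleCos z 3 0 2 + angleCos z 3 1 2)) : ℝ) : ℂ) := by
  have hn : ∀ j k, j ≠ k → ‖direction z j k‖ = 1 := fun j k h => norm_direction (hz.ne h)
  have h0 : ∀ j k, j ≠ k → direction z j k ≠ 0 := fun j k h => by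
    rw [← norm_ne_zero_iff, hn j k h]; exact one_ne_zero
  have hA : ∀ j k l, j ≠ k → j ≠ l →
      ((angleCos z j k l : ℝ) : ℂ) = unitCos (direction z j k) (direction z j l) :=
    fun j k l hk hl => ofReal_re_mul_conj (hn j k hk) (hn j l hl)
  have hO : ∀ j k l m, j ≠ k → j ≠ m → l ≠ m → l ≠ k → ((oppositeAngleCos z j k l m : ℝ) : ℂ) =
      unitCos (direction z j k * direction z l m) (direction z j m * direction z l k) := by
    intro j k l m h1 h2 h3 h4
    rw [← ofReal_re_mul_conj (by rw [norm_mul, hn _ _ h1, hn _ _ h3, one_mul])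
      (by rw [norm_mul, hn _ _ h2, hn _ _ h4, one_mul]), oppositeAngleCos, map_mul]
    congr 2; ring
  have key := det_cubicCoeff_units (h0 0 1 (by decide)) (h0 0 2 (by decide)) (h0 0 3 (by decide))
    (h0 1 2 (by decide)) (h0 1 3 (by decide)) (h0 2 3 (by decide))
  have i0 : Finset.Ioi (0 : Fin 4) = {1, 2, 3} := by decide
  have i1 : Finset.Ioi (1 : Fin 4) = {2, 3} := by decide
  have i2 : Finset.Ioi (2 : Fin 4) = {3} := by decide
  have i3 : Finset.Ioi (3 : Fin 4) = ∅ := by decide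
  have hp : (∏ j, ∏ k ∈ Finset.Ioi j, direction z j k) = direction z 0 1 * direction z 0 2 *
      direction z 0 3 * direction z 1 2 * direction z 1 3 * direction z 2 3 := by
    rw [Fin.prod_univ_four, i0, i1, i2, i3]; simp [mul_assoc]
  have hc : ∀ j k, j ≠ k → conj (direction z j k) = (direction z j k)⁻¹ :=
    fun j k h => conj_eq_inv_of_norm_eq_one (hn j k h)
  rw [angularPart, hp, symMatrix_four]
  push_cast
  rw [hO 0 1 2 3, hO 0 2 1 3, hO 0 1 3 2]
  rw [hA 1 2 3, hA 2 1 3, hA 3 1 2, hA 0 1 2, hA 0 1 3, hA 0 2 3, hA 2 0 3, hA 3 0 2, hA 1 0 2,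
    hA 1 0 3, hA 3 0 1, hA 2 0 1]
  rw [direction_swap z 0 1, direction_swap z 0 2, direction_swap z 0 3, direction_swap z 1 2,
    direction_swap z 1 3, direction_swap z 2 3]
  simp only [map_neg, mul_neg, neg_neg, unitCos_neg_left, unitCos_neg_right]
  rw [hc 0 1, hc 0 2, hc 0 3, hc 1 2, hc 1 3, hc 2 3, key]
  · ring
  all_goals decide

/-- Both factors change by the sign of the permutation: the product because `direction` is
antisymmetric, the determinant because its columns are permuted. -/
theorem angularPart_comp_perm {n : ℕ} (z : Fin n → ℂ) (σ : Equiv.Perm (Fin n)) :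
    angularPart (z ∘ σ) = angularPart z := by
  have h1 := σ.prod_Ioi_comp_eq_sign_mul_prod (f := direction z)
    (fun j k => direction_swap z k j)
  have h2 : symMatrix (fun j k => ((1 : ℂ), conj (direction (z ∘ σ) j k))) =
      (symMatrix fun j k => (1, conj (direction z j k))).submatrix id σ := by
    ext m k
    simp only [symMatrix, Matrix.of_apply, Matrix.submatrix_apply, id]
    congr 1
    refine Finset.prod_equiv σ (by simp) fun j _ => rfl
  have h3 : ((Equiv.Perm.sign σ : ℤ) : ℂ) * ((Equiv.Perm.sign σ : ℤ) : ℂ) = 1 := by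
    rw [← Int.cast_mul, ← Units.val_mul, Int.units_mul_self]; simp
  rw [angularPart, angularPart, h2, Matrix.det_permute']
  change (∏ j, ∏ k ∈ Finset.Ioi j, direction z (σ j) (σ k)) * _ = _
  rw [h1]
  linear_combination (∏ j, ∏ k ∈ Finset.Ioi j, direction z j k) *
    (symMatrix fun j k => ((1 : ℂ), conj (direction z j k))).det * h3

/-! ### The four triangles cut out by the diagonals -/

/-- For the triangle with vertices `0`, `a` and `b exp(iθ)`, the argument of the side `w` from `a`
to `b exp(iθ)` yields both base angles, `π - arg w` and `arg w - θ`. The last clause is the law of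
sines. -/
theorem exists_triangle_angles {a b θ : ℝ} (ha : 0 < a) (hb : 0 < b) (h0 : 0 < θ)
    (h1 : θ < Real.pi) :
    ∃ x y r : ℝ, 0 < x ∧ 0 < y ∧ 0 < r ∧ x + y = Real.pi - θ ∧
      (b : ℂ) * Complex.exp (θ * Complex.I) - a =
        r * Complex.exp ((Real.pi - x : ℝ) * Complex.I) ∧
      a * Real.sin x = b * Real.sin y := by
  set w : ℂ := (b : ℂ) * Complex.exp (θ * Complex.I) - a with hw
  have hs : 0 < Real.sin θ := Real.sin_pos_of_pos_of_lt_pi h0 h1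
  have him : w.im = b * Real.sin θ := by
    simp [hw, Complex.exp_ofReal_mul_I_im]
  have hre : w.re = b * Real.cos θ - a := by
    simp [hw, Complex.exp_ofReal_mul_I_re]
  have hwne : w ≠ 0 := fun h => by
    rw [h, Complex.zero_im] at him
    exact (mul_pos hb hs).ne him
  have hr : 0 < ‖w‖ := norm_pos_iff.mpr hwne
  have hi : ‖w‖ * Real.sin w.arg = b * Real.sin θ := by rw [Complex.norm_mul_sin_arg, him]
  have hc : ‖w‖ * Real.cos w.arg = b * Real.cos θ - a := by rw [Complex.norm_mul_cos_arg, hre]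
  have hd : ‖w‖ * Real.sin (w.arg - θ) = a * Real.sin θ := by
    rw [Real.sin_sub]
    linear_combination Real.cos θ * hi - Real.sin θ * hc
  have hψ : 0 < w.arg := by
    refine lt_of_le_of_ne (Complex.arg_nonneg_iff.mpr (by rw [him]; positivity)) fun h => ?_
    rw [← h, Real.sin_zero, mul_zero] at hi
    exact (mul_pos hb hs).ne hi
  have hψ' : w.arg < Real.pi := by
    refine lt_of_le_of_ne (Complex.arg_le_pi w) fun h => ?_
    rw [h, Real.sin_pi, mul_zero] at hi
    exact (mul_pos hb hs).ne hi
  have hy : 0 < w.arg - θ := by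
    by_contra! h
    have := Real.sin_nonpos_of_nonpos_of_neg_pi_le h (by linarith)
    nlinarith [mul_pos ha hs]
  refine ⟨Real.pi - w.arg, w.arg - θ, ‖w‖, by linarith, hy, hr, by ring, ?_, ?_⟩
  · rw [sub_sub_cancel, Complex.norm_mul_exp_arg_mul_I]
  · rw [Real.sin_pi_sub]
    apply mul_left_cancel₀ hr.ne'
    linear_combination a * hi - b * hd

theorem direction_eq_of_sub_eq {n : ℕ} {z : Fin n → ℂ} {j k : Fin n} {p : ℂ} {r φ : ℝ}
    (hp : ‖p‖ = 1) (hr : 0 < r)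
    (h : z k - z j = r * (p * Complex.exp (φ * Complex.I))) :
    direction z j k = p * Complex.exp (φ * Complex.I) := by
  have : (r : ℂ) ≠ 0 := by exact_mod_cast hr.ne'
  have hn : ‖z k - z j‖ = r := by
    rw [h, norm_mul, norm_mul, hp, Complex.norm_exp_ofReal_mul_I, Complex.norm_real,
      Real.norm_eq_abs, abs_of_pos hr]
    ring
  rw [direction, hn, h]
  field_simp

theorem direction_swap_eq {n : ℕ} {z : Fin n → ℂ} {j k : Fin n} {p : ℂ} {φ : ℝ}
    (h : direction z j k = p * Complex.exp (φ * Complex.I)) :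
    direction z k j = p * Complex.exp ((φ - Real.pi : ℝ) * Complex.I) := by
  rw [direction_swap, h]
  push_cast
  rw [sub_mul, Complex.exp_sub, Complex.exp_pi_mul_I]
  ring

theorem exp_mul_conj_exp (φ ψ : ℝ) : Complex.exp (φ * Complex.I) *
    conj (Complex.exp (ψ * Complex.I)) = Complex.exp ((φ - ψ : ℝ) * Complex.I) := by
  rw [← Complex.exp_conj, ← Complex.exp_add]
  congr 1
  simp
  ring

theorem mul_conj_of_norm_one {p : ℂ} (hp : ‖p‖ = 1) : p * conj p = 1 := by
  rw [Complex.mul_conj', hp]; simp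

theorem angleCos_eq_cos {n : ℕ} {z : Fin n → ℂ} {j k l : Fin n} {p : ℂ} {φ ψ : ℝ}
    (hp : ‖p‖ = 1) (h : direction z j k = p * Complex.exp (φ * Complex.I))
    (h' : direction z j l = p * Complex.exp (ψ * Complex.I)) :
    angleCos z j k l = Real.cos (φ - ψ) := by
  rw [angleCos, h, h', ← Complex.exp_ofReal_mul_I_re, ← exp_mul_conj_exp, map_mul]
  congr 1
  linear_combination (Complex.exp (φ * Complex.I) * conj (Complex.exp (ψ * Complex.I))) *
    mul_conj_of_norm_one hp

theorem oppositeAngleCos_eq_cos {n : ℕ} {z : Fin n → ℂ} {j k l m : Fin n} {p : ℂ}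
    {φ ψ φ' ψ' : ℝ} (hp : ‖p‖ = 1) (h₁ : direction z j k = p * Complex.exp (φ * Complex.I))
    (h₂ : direction z j m = p * Complex.exp (ψ * Complex.I))
    (h₃ : direction z l m = p * Complex.exp (φ' * Complex.I))
    (h₄ : direction z l k = p * Complex.exp (ψ' * Complex.I)) :
    oppositeAngleCos z j k l m = Real.cos ((φ - ψ) + (φ' - ψ')) := by
  have e : ∀ α β : ℝ, p * Complex.exp (α * Complex.I) * conj (p * Complex.exp (β * Complex.I)) =
      Complex.exp ((α - β : ℝ) * Complex.I) := by
    intro α β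
    rw [← exp_mul_conj_exp, map_mul]
    linear_combination (Complex.exp (α * Complex.I) * conj (Complex.exp (β * Complex.I))) *
      mul_conj_of_norm_one hp
  rw [oppositeAngleCos, h₁, h₂, h₃, h₄, e, e, ← Complex.exp_add, ← add_mul,
    ← Complex.ofReal_add, Complex.exp_ofReal_mul_I_re]

/-- The angular part is real and at least `64`. -/
def AngularBound {n : ℕ} (z : Fin n → ℂ) : Prop :=
  (angularPart z).im = 0 ∧ 64 ≤ (angularPart z).re

/-- With `o` as crossing point, all directions are written as `p exp(iφ)`, so every cosine in
`angularPart_eq` becomes the cosine of a combination of base angles and `quadrilateral_cos_le`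
applies. -/
theorem angularBound_of_diagonals_meet {z : Fin 4 → ℂ} (hz : Function.Injective z) {o p : ℂ}
    {a b c d θ : ℝ} (hp : ‖p‖ = 1) (ha : 0 < a) (hb : 0 < b) (hc : 0 < c) (hd : 0 < d)
    (h0 : 0 < θ) (h1 : θ < Real.pi) (z0 : z 0 = o + a * p)
    (z1 : z 1 = o + b * (p * Complex.exp (θ * Complex.I))) (z2 : z 2 = o - c * p)
    (z3 : z 3 = o - d * (p * Complex.exp (θ * Complex.I))) : AngularBound z := by
  obtain ⟨x₁, y₁, r₁, p₁, q₁, hr₁, s₁, e₁, l₁⟩ := exists_triangle_angles ha hb h0 h1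
  obtain ⟨x₂, y₂, r₂, p₂, q₂, hr₂, s₂, e₂, l₂⟩ := exists_triangle_angles hb hc
    (θ := Real.pi - θ) (by linarith) (by linarith)
  obtain ⟨x₃, y₃, r₃, p₃, q₃, hr₃, s₃, e₃, l₃⟩ := exists_triangle_angles hc hd h0 h1
  obtain ⟨x₄, y₄, r₄, p₄, q₄, hr₄, s₄, e₄, l₄⟩ := exists_triangle_angles hd ha
    (θ := Real.pi - θ) (by linarith) (by linarith)
  rw [sub_sub_cancel] at s₂ s₄
  have expπ : ∀ φ : ℝ, Complex.exp ((Real.pi - φ : ℝ) * Complex.I) =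
      -(Complex.exp (φ * Complex.I))⁻¹ := by
    intro φ
    push_cast
    rw [sub_mul, Complex.exp_sub, Complex.exp_pi_mul_I, neg_div, one_div]
  have expadd : ∀ φ ψ : ℝ, Complex.exp ((φ + ψ : ℝ) * Complex.I) =
      Complex.exp (φ * Complex.I) * Complex.exp (ψ * Complex.I) := by
    intro φ ψ
    push_cast
    rw [add_mul, Complex.exp_add]
  have expneg : ∀ φ : ℝ, Complex.exp ((-φ : ℝ) * Complex.I) =
      (Complex.exp (φ * Complex.I))⁻¹ := by
    intro φ
    push_cast
    rw [neg_mul, Complex.exp_neg]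
  have ne : ∀ φ : ℝ, Complex.exp (φ * Complex.I) ≠ 0 := fun φ => Complex.exp_ne_zero _
  have eπ : Complex.exp ((Real.pi : ℝ) * Complex.I) = -1 := Complex.exp_pi_mul_I
  rw [expπ] at e₁ e₃
  rw [expπ, expπ] at e₂ e₄
  have ac : 0 < a + c := by linarith
  have bd : 0 < b + d := by linarith
  -- The four triangles are described in the frames `p`, `p exp(iθ)`, `-p`, `-p exp(iθ)`; the
  -- arguments `φ` refer them all to the frame `p`, modulo `2π`.
  have d01 := direction_eq_of_sub_eq (z := z) (j := 0) (k := 1) (φ := Real.pi + -x₁) hp hr₁ (by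
    rw [z0, z1, expadd, expneg, eπ]; linear_combination p * e₁)
  have d12 := direction_eq_of_sub_eq (z := z) (j := 1) (k := 2) (φ := Real.pi + θ + -x₂) hp hr₂ (by
    rw [z1, z2, expadd, expadd, expneg, eπ]
    have := mul_inv_cancel₀ (ne θ)
    linear_combination p * Complex.exp (θ * Complex.I) * e₂ + p * c * this)
  have d23 := direction_eq_of_sub_eq (z := z) (j := 2) (k := 3) (φ := -x₃) hp hr₃ (by
    rw [z2, z3, expneg]; linear_combination -p * e₃)
  have d30 := direction_eq_of_sub_eq (z := z) (j := 3) (k := 0) (φ := θ + -x₄) hp hr₄ (by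
    rw [z3, z0, expadd, expneg]
    have := mul_inv_cancel₀ (ne θ)
    linear_combination -p * Complex.exp (θ * Complex.I) * e₄ - p * a * this)
  have d02 := direction_eq_of_sub_eq (z := z) (j := 0) (k := 2) (φ := Real.pi) hp ac (by
    rw [z0, z2, eπ]; push_cast; ring)
  have d13 := direction_eq_of_sub_eq (z := z) (j := 1) (k := 3) (φ := Real.pi + θ) hp bd (by
    rw [z1, z3, expadd, eπ]; push_cast; ring)
  have d10 := direction_swap_eq d01
  have d21 := direction_swap_eq d12
  have d32 := direction_swap_eq d23
  have d03 := direction_swap_eq d30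
  have d20 := direction_swap_eq d02
  have d31 := direction_swap_eq d13
  have hs : Real.sin x₁ * Real.sin x₃ * (Real.sin x₂ * Real.sin x₄) =
      Real.sin y₁ * Real.sin y₃ * (Real.sin y₂ * Real.sin y₄) := by
    have hne : a * b * c * d ≠ 0 := by positivity
    apply mul_left_cancel₀ hne
    -- Going once around `o`, the four laws of sines multiply and the lengths cancel.
    linear_combination (b * Real.sin x₂) * (c * Real.sin x₃) * (d * Real.sin x₄) * l₁
      + (b * Real.sin y₁) * (c * Real.sin x₃) * (d * Real.sin x₄) * l₂
      + (b * Real.sin y₁) * (c * Real.sin y₂) * (d * Real.sin x₄) * l₃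
      + (b * Real.sin y₁) * (c * Real.sin y₂) * (d * Real.sin y₃) * l₄
  have main := quadrilateral_cos_le p₁ q₁ p₂ q₂ p₃ q₃ p₄ q₄ s₁ s₂ s₃ s₄ hs
  have cosneg : ∀ {x y : ℝ}, x = -y → Real.cos x = Real.cos y := fun h => by rw [h, Real.cos_neg]
  have coseq : ∀ {x y : ℝ}, x = y → Real.cos x = Real.cos y := fun h => by rw [h]
  have cosper : ∀ {x y : ℝ}, x = y - 2 * Real.pi → Real.cos x = Real.cos y :=
    fun h => by rw [h, Real.cos_sub_two_pi]
  have cosadd : ∀ {x y : ℝ}, x = y + 2 * Real.pi → Real.cos x = Real.cos y :=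
    fun h => by rw [h, Real.cos_add_two_pi]
  have cosper' : ∀ {x y : ℝ}, x = -(y - 2 * Real.pi) → Real.cos x = Real.cos y :=
    fun h => by rw [h, Real.cos_neg, Real.cos_sub_two_pi]
  have A12 : angleCos z 0 1 2 = Real.cos x₁ :=
    (angleCos_eq_cos hp d01 d02).trans (cosneg (by linarith))
  have A13 : angleCos z 0 1 3 = Real.cos (x₁ + y₄) :=
    (angleCos_eq_cos hp d01 d03).trans (cosper' (by linarith))
  have A23 : angleCos z 0 2 3 = Real.cos y₄ :=
    (angleCos_eq_cos hp d02 d03).trans (cosper' (by linarith))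
  have B02 : angleCos z 1 0 2 = Real.cos (y₁ + x₂) :=
    (angleCos_eq_cos hp d10 d12).trans (cosper (by linarith))
  have B03 : angleCos z 1 0 3 = Real.cos y₁ :=
    (angleCos_eq_cos hp d10 d13).trans (cosper (by linarith))
  have B23 : angleCos z 1 2 3 = Real.cos x₂ :=
    (angleCos_eq_cos hp d12 d13).trans (cosneg (by linarith))
  have C01 : angleCos z 2 0 1 = Real.cos y₂ :=
    (angleCos_eq_cos hp d20 d21).trans (cosneg (by linarith))
  have C03 : angleCos z 2 0 3 = Real.cos x₃ :=
    (angleCos_eq_cos hp d20 d23).trans (coseq (by linarith))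
  have C13 : angleCos z 2 1 3 = Real.cos (y₂ + x₃) :=
    (angleCos_eq_cos hp d21 d23).trans (coseq (by linarith))
  have D01 : angleCos z 3 0 1 = Real.cos x₄ :=
    (angleCos_eq_cos hp d30 d31).trans (cosneg (by linarith))
  have D02 : angleCos z 3 0 2 = Real.cos (y₃ + x₄) :=
    (angleCos_eq_cos hp d30 d32).trans (cosper' (by linarith))
  have D12 : angleCos z 3 1 2 = Real.cos y₃ :=
    (angleCos_eq_cos hp d31 d32).trans (cosper' (by linarith))
  have K1 : oppositeAngleCos z 0 1 2 3 = Real.cos (x₁ + y₄ + (y₂ + x₃)) :=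
    (oppositeAngleCos_eq_cos hp d01 d03 d23 d21).trans (cosper' (by linarith))
  have K2 : oppositeAngleCos z 0 2 1 3 = Real.cos (x₂ - y₄) :=
    (oppositeAngleCos_eq_cos hp d02 d03 d13 d12).trans (cosadd (by linarith))
  have K3 : oppositeAngleCos z 0 1 3 2 = Real.cos (y₁ - x₃) :=
    (oppositeAngleCos_eq_cos hp d01 d02 d32 d31).trans (cosper (by linarith))
  rw [AngularBound, angularPart_eq hz, Complex.ofReal_im, Complex.ofReal_re, A12, A13, A23, B02,
    B03, B23, C01, C03, C13, D01, D02, D12, K1, K2, K3]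
  exact ⟨rfl, by linarith⟩

/-! ### Convex position and crossing diagonals -/

theorem ConvexIndependent.eq_or_eq_of_mem_segment {ι E : Type*} [AddCommGroup E] [Module ℝ E]
    {p : ι → E} (hp : ConvexIndependent ℝ p) {i j k : ι} (h : p i ∈ segment ℝ (p j) (p k)) :
    i = j ∨ i = k := by
  have := hp {j, k} i (by rwa [Set.image_pair, convexHull_pair])
  simpa using this

/-- The diagonals of a convex quadrilateral meet. -/
theorem exists_perm_segments_meet {z : Fin 4 → ℂ} (hz : ConvexIndependent ℝ z) :
    ∃ σ : Equiv.Perm (Fin 4),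
      (segment ℝ (z (σ 0)) (z (σ 2)) ∩ segment ℝ (z (σ 1)) (z (σ 3))).Nonempty := by
  have hdep : ¬ AffineIndependent ℝ z := fun h => by
    have h1 := h.card_le_finrank_succ
    have h2 := Submodule.finrank_le (vectorSpan ℝ (Set.range z))
    rw [Complex.finrank_real_complex] at h2
    rw [Fintype.card_fin] at h1
    omega
  -- Convex independence rules out a singleton part, so the Radon partition is two against two and
  -- its parts are the diagonals.
  obtain ⟨I, o, h1, h2⟩ := Convex.radon_partition hdep
  have two : ∀ J : Set (Fin 4), o ∈ convexHull ℝ (z '' J) → o ∈ convexHull ℝ (z '' Jᶜ) →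
      ∃ i ∈ J, ∃ k ∈ J, i ≠ k := by
    intro J h h'
    have hne : (z '' J).Nonempty := convexHull_nonempty_iff.mp ⟨o, h⟩
    obtain ⟨i, hi⟩ := Set.image_nonempty.mp hne
    by_contra! hJ
    have hJi : J = {i} := Set.eq_singleton_iff_unique_mem.mpr ⟨hi, fun k hk => hJ k hk i hi⟩
    rw [hJi, Set.image_singleton, convexHull_singleton, Set.mem_singleton_iff] at h
    rw [h] at h'
    exact hz _ _ h' hi
  obtain ⟨i, hi, k, hk, hik⟩ := two I h1 h2
  obtain ⟨j, hj, l, hl, hjl⟩ := two Iᶜ h2 (by rwa [compl_compl])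
  have ne : ∀ {a b}, a ∈ I → b ∈ Iᶜ → a ≠ b := fun ha hb h => hb (h ▸ ha)
  have all : ∀ i j k l m : Fin 4, i ≠ k → j ≠ l → i ≠ j → i ≠ l → k ≠ j → k ≠ l →
      m = i ∨ m = j ∨ m = k ∨ m = l := by decide
  have hall := fun m => all i j k l m hik hjl (ne hi hj) (ne hi hl) (ne hk hj) (ne hk hl)
  have hI : I ⊆ {i, k} := by
    intro m hm
    rcases hall m with h | h | h | h
    · simp [h]
    · exact absurd h (ne hm hj)
    · simp [h]
    · exact absurd h (ne hm hl)
  have hI' : Iᶜ ⊆ {j, l} := by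
    intro m hm
    rcases hall m with h | h | h | h
    · exact absurd h.symm (ne hi hm)
    · simp [h]
    · exact absurd h.symm (ne hk hm)
    · simp [h]
  have hsurj : Function.Surjective ![i, j, k, l] := by
    intro m
    rcases hall m with h | h | h | h
    · exact ⟨0, h.symm⟩
    · exact ⟨1, h.symm⟩
    · exact ⟨2, h.symm⟩
    · exact ⟨3, h.symm⟩
  refine ⟨Equiv.ofBijective _ (Finite.injective_iff_bijective.mp
    (Finite.injective_iff_surjective.mpr hsurj)), o, ?_, ?_⟩
  · have := convexHull_mono (Set.image_mono hI) h1
    rwa [Set.image_pair, convexHull_pair] at this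
  · have := convexHull_mono (Set.image_mono hI') h2
    rwa [Set.image_pair, convexHull_pair] at this

theorem add_smul_mem_segment {E : Type*} [AddCommGroup E] [Module ℝ E] (o v : E) {x y c : ℝ}
    (h1 : -c ≤ x) (h2 : x ≤ y) (h : 0 < y + c) :
    o + x • v ∈ segment ℝ (o + y • v) (o - c • v) := by
  refine ⟨(x + c) / (y + c), (y - x) / (y + c), div_nonneg (by linarith) h.le,
    div_nonneg (by linarith) h.le, by field_simp; ring, ?_⟩
  have h0 : y + c ≠ 0 := h.ne'
  have e1 : (x + c) / (y + c) + (y - x) / (y + c) = 1 := by field_simp; ring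
  have e2 : (x + c) / (y + c) * y - (y - x) / (y + c) * c = x := by field_simp; ring
  calc _ = ((x + c) / (y + c) + (y - x) / (y + c)) • o +
        ((x + c) / (y + c) * y - (y - x) / (y + c) * c) • v := by module
    _ = _ := by rw [e1, e2, one_smul]

/-- Two segments that meet at interior points do not lie on one line, if their endpoints are convex
independent. -/
theorem ConvexIndependent.not_parallel {z : Fin 4 → ℂ} (hz : ConvexIndependent ℝ z) {o v : ℂ}
    {a b c d : ℝ} (ha : 0 < a) (hb : 0 < b) (hc : 0 < c) (hd : 0 < d) (z0 : z 0 = o + a • v)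
    (z1 : z 1 = o + b • v) (z2 : z 2 = o - c • v) (z3 : z 3 = o - d • v) : False := by
  rcases le_total a b with h | h
  · have := add_smul_mem_segment o v (x := a) (y := b) (c := d) (by linarith) h (by linarith)
    rw [← z0, ← z1, ← z3] at this
    exact absurd (hz.eq_or_eq_of_mem_segment this) (by decide)
  · have := add_smul_mem_segment o v (x := b) (y := a) (c := c) (by linarith) h (by linarith)
    rw [← z0, ← z1, ← z2] at this
    exact absurd (hz.eq_or_eq_of_mem_segment this) (by decide)

theorem angularBound_comp_perm {n : ℕ} {z : Fin n → ℂ} (σ : Equiv.Perm (Fin n)) :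
    AngularBound (z ∘ σ) ↔ AngularBound z := by
  rw [AngularBound, angularPart_comp_perm, AngularBound]

/-- The crossing point is interior to both diagonals, as an endpoint of one cannot lie on the other.
The oriented angle `θ` between the diagonals is neither `0` nor `π` by `not_parallel`; if it is
negative, exchanging the vertices 1 and 3 replaces it by `θ + π`. -/
theorem angularBound_of_segments_meet {z : Fin 4 → ℂ} (hz : ConvexIndependent ℝ z)
    (h : (segment ℝ (z 0) (z 2) ∩ segment ℝ (z 1) (z 3)).Nonempty) : AngularBound z := by
  obtain ⟨o, ⟨s, t, hs, ht, hst, ho⟩, ⟨s', t', hs', ht', hst', ho'⟩⟩ := h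
  have seg : ∀ i j k l : Fin 4, i ≠ j → i ≠ k → ∀ s t : ℝ, 0 ≤ s → 0 ≤ t → s + t = 1 →
      s • z j + t • z k ≠ z i := fun i j k l hj hk s t hs ht hst h =>
    (hz.eq_or_eq_of_mem_segment ⟨s, t, hs, ht, hst, h⟩).elim hj hk
  have pos : ∀ {x y : ℝ} {u w : ℂ}, 0 ≤ x → x + y = 1 → x • u + y • w = o → o ≠ w → 0 < x := by
    intro x y u w hx hxy h hne
    refine lt_of_le_of_ne hx fun h0 => hne ?_
    rw [← h0, zero_add] at hxy
    rw [← h, ← h0, hxy]; simp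
  have hs0 : 0 < s := pos hs hst ho (ho' ▸ seg 2 1 3 0 (by decide) (by decide) _ _ hs' ht' hst')
  have ht0 : 0 < t := pos ht ((add_comm _ _).trans hst) ((add_comm _ _).trans ho)
    (ho' ▸ seg 0 1 3 0 (by decide) (by decide) _ _ hs' ht' hst')
  have hs0' : 0 < s' := pos hs' hst' ho' (ho ▸ seg 3 0 2 0 (by decide) (by decide) _ _ hs ht hst)
  have ht0' : 0 < t' := pos ht' ((add_comm _ _).trans hst') ((add_comm _ _).trans ho')
    (ho ▸ seg 1 0 2 0 (by decide) (by decide) _ _ hs ht hst)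
  have hv : z 0 - z 2 ≠ 0 := sub_ne_zero.mpr (hz.injective.ne (by decide))
  have hw : z 1 - z 3 ≠ 0 := sub_ne_zero.mpr (hz.injective.ne (by decide))
  obtain ⟨v, hvd⟩ : ∃ v, v = z 0 - z 2 := ⟨_, rfl⟩
  obtain ⟨w, hwd⟩ : ∃ w, w = z 1 - z 3 := ⟨_, rfl⟩
  rw [← hvd] at hv
  rw [← hwd] at hw
  have hst_ : (s : ℂ) + t = 1 := by exact_mod_cast hst
  have hst_' : (s' : ℂ) + t' = 1 := by exact_mod_cast hst'
  rw [Complex.real_smul, Complex.real_smul] at ho ho'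
  have z0 : z 0 = o + t * v := by rw [hvd]; linear_combination -z 0 * hst_ + ho
  have z2 : z 2 = o - s * v := by rw [hvd]; linear_combination -z 2 * hst_ + ho
  have z1 : z 1 = o + t' * w := by rw [hwd]; linear_combination -z 1 * hst_' + ho'
  have z3 : z 3 = o - s' * w := by rw [hwd]; linear_combination -z 3 * hst_' + ho'
  have hnv : 0 < ‖v‖ := norm_pos_iff.mpr hv
  have hnw : 0 < ‖w‖ := norm_pos_iff.mpr hw
  have hnv' : (‖v‖ : ℂ) ≠ 0 := by exact_mod_cast hnv.ne'
  set θ := (w / v).arg with hθ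
  have hwv : w = ‖w‖ * (v / ‖v‖ * Complex.exp (θ * Complex.I)) := by
    have := Complex.norm_mul_exp_arg_mul_I (w / v)
    rw [← hθ, norm_div] at this
    push_cast at this
    rw [div_mul_eq_mul_div, div_eq_div_iff hnv' hv] at this
    field_simp
    linear_combination -this
  have hvp : v = ‖v‖ * (v / ‖v‖) := by field_simp
  have hp : ‖v / ‖v‖‖ = 1 := by
    rw [norm_div, Complex.norm_real, norm_norm, div_self hnv.ne']
  generalize v / ‖v‖ = p at hwv hvp hp
  rw [hvp] at z0 z2
  rw [hwv] at z1 z3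
  rcases lt_trichotomy θ 0 with h | h | h
  · rw [← angularBound_comp_perm (Equiv.swap 1 3)]
    have hpi := Complex.neg_pi_lt_arg (w / v)
    have e : Complex.exp ((θ + Real.pi : ℝ) * Complex.I) = -Complex.exp (θ * Complex.I) := by
      push_cast
      rw [add_mul, Complex.exp_add, Complex.exp_pi_mul_I]; ring
    refine angularBound_of_diagonals_meet (hz.injective.comp (Equiv.injective _)) (o := o) hp
      (mul_pos ht0 hnv) (mul_pos hs0' hnw) (mul_pos hs0 hnv) (mul_pos ht0' hnw)
      (θ := θ + Real.pi) (by linarith) (by linarith) ?_ ?_ ?_ ?_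
    · change z 0 = _
      rw [z0]; push_cast; ring
    · change z 3 = _
      rw [z3, e]; push_cast; ring
    · change z 2 = _
      rw [z2]; push_cast; ring
    · change z 1 = _
      rw [z1, e]; push_cast; ring
  · exfalso
    rw [h] at z1 z3
    refine hz.not_parallel (o := o) (v := p) (mul_pos ht0 hnv) (mul_pos ht0' hnw)
      (mul_pos hs0 hnv) (mul_pos hs0' hnw) ?_ ?_ ?_ ?_ <;>
      simp only [z0, z1, z2, z3, Complex.real_smul] <;> simp [mul_assoc]
  · rcases (Complex.arg_le_pi (w / v)).lt_or_eq with hpi | hpi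
    · refine angularBound_of_diagonals_meet hz.injective (o := o) hp (mul_pos ht0 hnv)
        (mul_pos ht0' hnw) (mul_pos hs0 hnv) (mul_pos hs0' hnw) h hpi ?_ ?_ ?_ ?_
      · rw [z0]; push_cast; ring
      · rw [z1]; push_cast; ring
      · rw [z2]; push_cast; ring
      · rw [z3]; push_cast; ring
    · exfalso
      rw [hθ, hpi, Complex.exp_pi_mul_I] at z1 z3
      have hz' : ConvexIndependent ℝ (z ∘ Equiv.swap 1 3) :=
        hz.comp_embedding (Equiv.swap (1 : Fin 4) 3).toEmbedding
      refine hz'.not_parallel (o := o) (v := p) (mul_pos ht0 hnv) (mul_pos hs0' hnw)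
        (mul_pos hs0 hnv) (mul_pos ht0' hnw) ?_ ?_ ?_ ?_
      · change z 0 = _
        rw [z0, Complex.real_smul]; push_cast; ring
      · change z 3 = _
        rw [z3, Complex.real_smul]; push_cast; ring
      · change z 2 = _
        rw [z2, Complex.real_smul]; push_cast; ring
      · change z 1 = _
        rw [z1, Complex.real_smul]; push_cast; ring

theorem angularBound_of_convexIndependent {z : Fin 4 → ℂ} (hz : ConvexIndependent ℝ z) :
    AngularBound z := by
  obtain ⟨σ, hσ⟩ := exists_perm_segments_meet hz
  rw [← angularBound_comp_perm σ]
  exact angularBound_of_segments_meet (hz.comp_embedding σ.toEmbedding) hσ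

/-! ### Lifts in the plane and the splitting off of distances -/

theorem det_symMatrix_mul {n : ℕ} (e : Fin n → Fin n → ℂ) (v : Fin n → Fin n → ℂ × ℂ) :
    (symMatrix fun j k => (e j k * (v j k).1, e j k * (v j k).2)).det =
      (∏ k, ∏ j ∈ Finset.univ.erase k, e k j) * (symMatrix v).det := by
  rw [← Matrix.det_mul_row]
  congr 1
  ext m k
  simp only [symMatrix, Matrix.of_apply]
  rw [← Polynomial.coeff_C_mul, map_prod, ← Finset.prod_mul_distrib]
  congr 1
  refine Finset.prod_congr rfl fun j _ => ?_
  simp only [map_mul]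
  ring

theorem hopf_sqrt_mul {r : ℝ} (hr : 0 ≤ r) {u : ℂ} (hu : ‖u‖ = 1) :
    hopf ((√r : ℂ) * 1, (√r : ℂ) * conj u) = planePoint (r * u) := by
  have h : (√r : ℂ) * √r = r := by rw [← Complex.ofReal_mul, Real.mul_self_sqrt hr]
  rw [hopf, planePoint]
  congr 2
  · simp [hu]
  · rw [map_mul, Complex.conj_conj, Complex.conj_ofReal]
    linear_combination u * h

theorem planePoint_sub (z w : ℂ) : planePoint z - planePoint w = planePoint (z - w) := by
  rw [planePoint, planePoint, planePoint, ← WithLp.toLp_sub, Prod.mk_sub_mk, sub_zero]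

theorem norm_mul_direction {n : ℕ} (z : Fin n → ℂ) (j k : Fin n) :
    (dist (z j) (z k) : ℂ) * direction z j k = z k - z j := by
  rw [dist_comm, dist_eq_norm, direction]
  by_cases h : z k - z j = 0
  · simp [h]
  · have : (‖z k - z j‖ : ℂ) ≠ 0 := by exact_mod_cast norm_ne_zero_iff.mpr h
    field_simp

/-- The phase of the normalized lifts of the vectors between points of the plane `{0} × ℂ`. -/
noncomputable def liftPhase {n : ℕ} (z : Fin n → ℂ) (j k : Fin n) : ℂ :=
  if j < k then 1 else direction z j k

/-- The antipode of `√r (1, conj u)` is `-u √r (1, -conj u)`, which is the lift of the same shape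
for the direction `-u`, multiplied by the phase `-u`. -/
theorem isLiftFamily_plane {n : ℕ} {z : Fin n → ℂ} (hz : Function.Injective z) :
    IsLiftFamily (fun j => planePoint (z j)) fun j k =>
      (liftPhase z j k * (√(dist (z j) (z k)) : ℂ) * 1,
        liftPhase z j k * (√(dist (z j) (z k)) : ℂ) * conj (direction z j k)) where
  hopf_eq j k h := by
    simp only [liftPhase, if_pos h, one_mul]
    rw [hopf_sqrt_mul dist_nonneg (norm_direction (hz.ne h.ne)), norm_mul_direction,
      planePoint_sub]
  antipode_eq j k h := by
    have hu := mul_conj_of_norm_one (norm_direction (hz.ne h.ne))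
    simp only [liftPhase, if_pos h, if_neg h.not_gt, antipode, direction_swap z j k,
      dist_comm (z k) (z j), map_mul, map_one, Complex.conj_conj, Complex.conj_ofReal, map_neg]
    refine Prod.ext (by ring) ?_
    linear_combination (√(dist (z j) (z k)) : ℂ) * hu

/-- Each root `√r` occurs for both orders of a pair and gives the distance. The phases give the
product of the `-u_jk`, `j < k`; for four points the six signs cancel. -/
theorem atiyahDet_planePoint {z : Fin 4 → ℂ} (hz : Function.Injective z) :
    atiyahDet (fun j => planePoint (z j)) =
      ((∏ j, ∏ k ∈ Finset.Ioi j, dist (z j) (z k) : ℝ) : ℂ) * angularPart z := by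
  rw [← atiyahDet_eq_of_isLiftFamily (isLiftFamily_plane hz),
    det_symMatrix_mul (fun j k => liftPhase z j k * (√(dist (z j) (z k)) : ℂ))
      (fun j k => (1, conj (direction z j k))), angularPart, ← mul_assoc]
  congr 1
  have e0 : (Finset.univ.erase 0 : Finset (Fin 4)) = {1, 2, 3} := by decide
  have e1 : (Finset.univ.erase 1 : Finset (Fin 4)) = {0, 2, 3} := by decide
  have e2 : (Finset.univ.erase 2 : Finset (Fin 4)) = {0, 1, 3} := by decide
  have e3 : (Finset.univ.erase 3 : Finset (Fin 4)) = {0, 1, 2} := by decide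
  have i0 : Finset.Ioi (0 : Fin 4) = {1, 2, 3} := by decide
  have i1 : Finset.Ioi (1 : Fin 4) = {2, 3} := by decide
  have i2 : Finset.Ioi (2 : Fin 4) = {3} := by decide
  have i3 : Finset.Ioi (3 : Fin 4) = ∅ := by decide
  have three : ∀ (f : Fin 4 → ℂ) (i j k : Fin 4), i ≠ j → i ≠ k → j ≠ k →
      ∏ m ∈ ({i, j, k} : Finset (Fin 4)), f m = f i * f j * f k := by
    intro f i j k hij hik hjk
    rw [Finset.prod_insert (by simp [hij, hik]), Finset.prod_pair hjk, mul_assoc]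
  have hs : ∀ j k, (dist (z j) (z k) : ℂ) = (√(dist (z j) (z k)) : ℂ) ^ 2 := by
    intro j k
    rw [← Complex.ofReal_pow, Real.sq_sqrt dist_nonneg]
  push_cast
  rw [Fin.prod_univ_four, Fin.prod_univ_four, Fin.prod_univ_four, e0, e1, e2, e3, i0, i1, i2, i3]
  rw [three, three, three, three, three, three, Finset.prod_pair, Finset.prod_pair,
    Finset.prod_singleton, Finset.prod_singleton, Finset.prod_empty, Finset.prod_empty]
  · rw [dist_comm (z 1) (z 0), dist_comm (z 2) (z 0), dist_comm (z 3) (z 0), dist_comm (z 2) (z 1),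
      dist_comm (z 3) (z 1), dist_comm (z 3) (z 2)]
    simp only [hs]
    have p1 : ∀ j k, j < k → liftPhase z j k = 1 := fun j k h => if_pos h
    have p2 : ∀ j k, j < k → liftPhase z k j = -direction z j k := fun j k h => by
      rw [liftPhase, if_neg h.not_gt, direction_swap]
    rw [p1 0 1, p1 0 2, p1 0 3, p1 1 2, p1 1 3, p1 2 3, p2 0 1, p2 0 2, p2 0 3, p2 1 2, p2 1 3,
      p2 2 3]
    · ring
    all_goals decide
  all_goals decide

/-! ### Rotation of coplanar points into the plane -/

/-- The action of the matrix with the rows `(a, b)` and `(-conj b, conj a)`. -/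
def unitaryAct (a b : ℂ) (v : ℂ × ℂ) : ℂ × ℂ :=
  (a * v.1 + b * v.2, -conj b * v.1 + conj a * v.2)

/-- The map of three-space that corresponds to `unitaryAct` under the Hopf map. -/
noncomputable def hopfRotation (a b : ℂ) : Space →ₗ[ℝ] Space where
  toFun V := WithLp.toLp 2 ((‖a‖ ^ 2 - ‖b‖ ^ 2) * V.fst + 2 * (a * conj b * V.snd).re,
    -2 * a * b * V.fst + a ^ 2 * V.snd - b ^ 2 * conj V.snd)
  map_add' V W := by
    refine WithLp.ofLp_injective 2 (Prod.ext ?_ ?_)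
    · simp only [WithLp.ofLp_add, Prod.fst_add, WithLp.add_fst, WithLp.add_snd, mul_add,
        Complex.add_re]
      ring
    · simp only [WithLp.ofLp_add, Prod.snd_add, WithLp.add_fst, WithLp.add_snd, map_add,
        Complex.ofReal_add]
      ring
  map_smul' c V := by
    refine WithLp.ofLp_injective 2 (Prod.ext ?_ ?_)
    · simp; ring
    · simp; ring

theorem hopf_unitaryAct (a b : ℂ) (v : ℂ × ℂ) :
    hopf (unitaryAct a b v) = hopfRotation a b (hopf v) := by
  have nsq : ∀ w : ℂ, ‖w‖ ^ 2 = w.re * w.re + w.im * w.im := fun w => by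
    rw [← Complex.normSq_eq_norm_sq, Complex.normSq_apply]
  change WithLp.toLp 2 _ = WithLp.toLp 2 _
  congr 1
  refine Prod.ext ?_ ?_
  · simp only [hopf, unitaryAct, nsq]
    simp
    ring
  · have h1 : (((‖v.1‖ ^ 2 - ‖v.2‖ ^ 2) / 2 : ℝ) : ℂ) = (v.1 * conj v.1 - v.2 * conj v.2) / 2 := by
      rw [Complex.mul_conj', Complex.mul_conj']; push_cast; ring
    simp only [hopf, unitaryAct, WithLp.toLp_fst, WithLp.toLp_snd, h1, map_add, map_mul, map_neg, Complex.conj_conj]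
    ring

theorem antipode_unitaryAct (a b : ℂ) (v : ℂ × ℂ) :
    antipode (unitaryAct a b v) = unitaryAct a b (antipode v) := by
  simp only [antipode, unitaryAct, map_add, map_mul, map_neg, Complex.conj_conj]
  refine Prod.ext ?_ ?_ <;> ring

theorem norm_hopf (v : ℂ × ℂ) : ‖hopf v‖ = (‖v.1‖ ^ 2 + ‖v.2‖ ^ 2) / 2 := by
  rw [← sq_eq_sq₀ (norm_nonneg _) (by positivity), WithLp.prod_norm_sq_eq_of_L2]
  simp only [hopf, WithLp.toLp_fst, WithLp.toLp_snd, Real.norm_eq_abs, sq_abs, norm_mul, RCLike.norm_conj]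
  ring

theorem norm_rotation {a b : ℂ} (h : ‖a‖ ^ 2 + ‖b‖ ^ 2 = 1) (V : Space) :
    ‖hopfRotation a b V‖ = ‖V‖ := by
  obtain ⟨v, rfl⟩ : ∃ v, hopf v = V := ⟨_, hopf_hopfLift V⟩
  rw [← hopf_unitaryAct, norm_hopf, norm_hopf]
  have nsq : ∀ w : ℂ, ‖w‖ ^ 2 = w.re * w.re + w.im * w.im := fun w => by
    rw [← Complex.normSq_eq_norm_sq, Complex.normSq_apply]
  simp only [nsq, unitaryAct] at h ⊢
  simp
  linear_combination (v.1.re * v.1.re + v.1.im * v.1.im + (v.2.re * v.2.re + v.2.im * v.2.im)) * h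

/-- The columns transform by the symmetric cube `S` of the matrix, and `det S` is the sixth power of
its determinant `‖a‖² + ‖b‖²`. The vectors `p` and `q` are the images of the standard basis. -/
theorem det_symMatrix_unitaryAct {a b : ℂ} (h : ‖a‖ ^ 2 + ‖b‖ ^ 2 = 1)
    (v : Fin 4 → Fin 4 → ℂ × ℂ) :
    (symMatrix fun j k => unitaryAct a b (v j k)).det = (symMatrix v).det := by
  let p : ℂ × ℂ := (a, -conj b)
  let q : ℂ × ℂ := (b, conj a)
  let S : Matrix (Fin 4) (Fin 4) ℂ := Matrix.of fun m l =>
    ![cubicCoeff p p p, cubicCoeff p p q, cubicCoeff p q q, cubicCoeff q q q] l m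
  have hS : S.det = 1 := by
    have h1 : a * conj a + b * conj b = 1 := by
      rw [Complex.mul_conj', Complex.mul_conj']; exact_mod_cast h
    have h2 : S.det = (a * conj a + b * conj b) ^ 6 := by
      rw [det_fin_four]
      simp only [S, cubicCoeff, Matrix.of_apply, Matrix.cons_val, p, q]
      ring
    rw [h2, h1, one_pow]
  have hc : ∀ u v w m, cubicCoeff (unitaryAct a b u) (unitaryAct a b v) (unitaryAct a b w) m =
      ∑ l, S m l * cubicCoeff u v w l := by
    intro u v w m
    rw [Fin.sum_univ_four]
    fin_cases m <;>
      simp [S, cubicCoeff, unitaryAct, p, q] <;> ring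
  have hM : (symMatrix fun j k => unitaryAct a b (v j k)) = S * symMatrix v := by
    rw [symMatrix_four, symMatrix_four]
    ext m k
    rw [Matrix.mul_apply]
    fin_cases k <;> exact hc _ _ _ m
  rw [hM, Matrix.det_mul, hS, one_mul]

theorem finrank_space : Module.finrank ℝ Space = 3 := by
  rw [(WithLp.linearEquiv 2 ℝ (ℝ × ℂ)).finrank_eq, Module.finrank_prod, Module.finrank_self,
    Complex.finrank_real_complex]

/-- A coplanar family can be rotated into a plane parallel to `{0} × ℂ`. -/
theorem exists_rotation_of_coplanar {ι : Type*} {P : ι → Space}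
    (hP : Coplanar ℝ (Set.range P)) :
    ∃ a b : ℂ, ‖a‖ ^ 2 + ‖b‖ ^ 2 = 1 ∧ ∀ j k, (hopfRotation a b (P k - P j)).fst = 0 := by
  have : FiniteDimensional ℝ Space := Module.finite_of_finrank_pos (by simp [finrank_space])
  have hne : vectorSpan ℝ (Set.range P) ≠ ⊤ := fun h => by
    have h2 := (coplanar_iff_finrank_le_two).mp hP
    rw [h, finrank_top, finrank_space] at h2
    omega
  obtain ⟨N, hN, hN0⟩ := Submodule.exists_mem_ne_zero_of_ne_bot
    (mt Submodule.orthogonal_eq_bot_iff.mp hne)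
  obtain ⟨c, hc⟩ : ∃ c : ℝ, ‖c • N‖ = 1 := ⟨‖N‖⁻¹, by
    rw [norm_smul, norm_inv, norm_norm, inv_mul_cancel₀ (norm_ne_zero_iff.mpr hN0)]⟩
  have hN' := Submodule.smul_mem _ c hN
  generalize c • N = M at hc hN'
  -- For this `v = (a, b)` the first coordinate of `hopfRotation a b V` is the inner product of `V`
  -- with the unit normal `M`. The factor `1/2` makes `‖a‖² + ‖b‖² = 1`, by `norm_hopf`.
  obtain ⟨v, hv⟩ : ∃ v, hopf v = WithLp.toLp 2 (M.fst / 2, conj M.snd / 2) := ⟨_, hopf_hopfLift _⟩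
  have hv1 : (‖v.1‖ ^ 2 - ‖v.2‖ ^ 2) / 2 = M.fst / 2 := congrArg (fun W => W.fst) hv
  have hv2 : v.1 * conj v.2 = conj M.snd / 2 := congrArg (fun W => W.snd) hv
  refine ⟨v.1, v.2, ?_, fun j k => ?_⟩
  · have h1 := norm_hopf v
    have h2 : ‖hopf v‖ = 1 / 2 := by
      rw [← sq_eq_sq₀ (norm_nonneg _) (by norm_num), hv, WithLp.prod_norm_sq_eq_of_L2]
      have h3 := WithLp.prod_norm_sq_eq_of_L2 M
      rw [hc] at h3
      simp only [WithLp.toLp_fst, WithLp.toLp_snd, norm_div, RCLike.norm_conj, Real.norm_ofNat, Complex.norm_ofNat]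
      linarith
    linarith
  · have hi := Submodule.inner_left_of_mem_orthogonal (vsub_mem_vectorSpan ℝ
      (Set.mem_range_self k) (Set.mem_range_self j) : P k -ᵥ P j ∈ _) hN'
    rw [vsub_eq_sub] at hi
    generalize P k - P j = V at hi ⊢
    rw [WithLp.prod_inner_apply, Complex.inner] at hi
    change (‖v.1‖ ^ 2 - ‖v.2‖ ^ 2) * V.fst + 2 * (v.1 * conj v.2 * V.snd).re = 0
    rw [hv2, show ‖v.1‖ ^ 2 - ‖v.2‖ ^ 2 = M.fst by linarith]
    simp at hi ⊢
    linarith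

theorem ConvexIndependent.of_affineMap {ι E F : Type*} [AddCommGroup E] [Module ℝ E]
    [AddCommGroup F] [Module ℝ F] {p : ι → E} (f : E →ᵃ[ℝ] F)
    (h : ConvexIndependent ℝ (f ∘ p)) : ConvexIndependent ℝ p := by
  intro s i hi
  refine h s i ?_
  rw [Set.image_comp, ← f.image_convexHull]
  exact Set.mem_image_of_mem f hi

theorem ConvexIndependent.affineMap_comp {ι E F : Type*} [AddCommGroup E] [Module ℝ E]
    [AddCommGroup F] [Module ℝ F] {p : ι → E} (h : ConvexIndependent ℝ p) (f : E →ᵃ[ℝ] F)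
    (hf : Function.Injective f) : ConvexIndependent ℝ (f ∘ p) := by
  intro s i hi
  rw [Set.image_comp, ← f.image_convexHull] at hi
  exact h s i (hf.mem_set_image.mp hi)

/-- The inclusion of the plane `{0} × ℂ`. -/
noncomputable def planePointLinear : ℂ →ₗ[ℝ] Space where
  toFun := planePoint
  map_add' z w := by simp [planePoint, ← WithLp.toLp_add]
  map_smul' c z := by simp [planePoint, ← WithLp.toLp_smul]

theorem dist_planePoint (z w : ℂ) : dist (planePoint z) (planePoint w) = dist z w := by
  rw [dist_eq_norm, planePoint_sub, dist_eq_norm,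
    ← sq_eq_sq₀ (norm_nonneg _) (norm_nonneg _), WithLp.prod_norm_sq_eq_of_L2]
  simp [planePoint]

/-- A coplanar convex independent family of four points has the Atiyah determinant and the
distances of a convex independent family in the plane `{0} × ℂ`. -/
theorem exists_plane_model {P : Fin 4 → Space} (hP : Coplanar ℝ (Set.range P))
    (hc : ConvexIndependent ℝ P) :
    ∃ z : Fin 4 → ℂ, ConvexIndependent ℝ z ∧ (∀ j k, dist (z j) (z k) = dist (P j) (P k)) ∧
      atiyahDet P = atiyahDet fun j => planePoint (z j) := by
  obtain ⟨a, b, hab, hf⟩ := exists_rotation_of_coplanar hP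
  let R := hopfRotation a b
  -- The translation sends `P 0` to the origin, so the rotated plane becomes `{0} × ℂ` itself.
  let f : Space →ᵃ[ℝ] Space := R.toAffineMap - AffineMap.const ℝ Space (R (P 0))
  have hfR : ∀ V, f V = R V - R (P 0) := fun V => rfl
  have hinj : Function.Injective f := fun V W h => by
    rw [hfR, hfR, sub_left_inj] at h
    rw [← sub_eq_zero, ← norm_eq_zero, ← norm_rotation hab, map_sub, norm_eq_zero, sub_eq_zero]
    exact h
  let z : Fin 4 → ℂ := fun j => (f (P j)).snd
  have hz : ∀ j, planePoint (z j) = f (P j) := fun j => by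
    have h := hf 0 j
    rw [map_sub] at h
    exact WithLp.ofLp_injective 2 (Prod.ext h.symm rfl)
  have hsub : ∀ j k, planePoint (z k) - planePoint (z j) = R (P k - P j) := fun j k => by
    rw [hz, hz, hfR, hfR, sub_sub_sub_cancel_right, map_sub]
  refine ⟨z, ?_, fun j k => ?_, ?_⟩
  · refine ConvexIndependent.of_affineMap planePointLinear.toAffineMap ?_
    have : planePointLinear.toAffineMap ∘ z = f ∘ P := funext hz
    rw [this]
    exact hc.affineMap_comp f hinj
  · rw [← dist_planePoint, dist_eq_norm, hsub, norm_rotation hab, dist_eq_norm]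
  · rw [atiyahDet, ← det_symMatrix_unitaryAct hab]
    -- The transformed standard lifts are normalized lifts of the rotated points, because the action
    -- is compatible with `hopf` and `antipode`.
    refine atiyahDet_eq_of_isLiftFamily ⟨fun j k h => ?_, fun j k h => ?_⟩
    · rw [hopf_unitaryAct, (isLiftFamily_stdLifts P).hopf_eq j k h, hsub]
    · rw [antipode_unitaryAct, (isLiftFamily_stdLifts P).antipode_eq j k h]

/-- The Atiyah determinant of four coplanar points in convex position (in any order) is real and
at least the product of the doubled distances; for points of the plane `{0} × ℂ` it is the product
of the distances times the angular part, which is real and at least `64`. -/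
theorem mainTheorem1 :
    (∀ P : Fin 4 → Space, Coplanar ℝ (Set.range P) → ConvexIndependent ℝ P →
      (atiyahDet P).im = 0 ∧
        ∏ j, ∏ k ∈ Finset.Ioi j, (2 * dist (P j) (P k)) ≤ (atiyahDet P).re) ∧
    (∀ z : Fin 4 → ℂ, ConvexIndependent ℝ z →
      atiyahDet (fun j => planePoint (z j)) =
          ((∏ j, ∏ k ∈ Finset.Ioi j, dist (z j) (z k) : ℝ) : ℂ) * angularPart z ∧
        (angularPart z).im = 0 ∧ 64 ≤ (angularPart z).re) := by
  have plane : ∀ z : Fin 4 → ℂ, ConvexIndependent ℝ z →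
      atiyahDet (fun j => planePoint (z j)) =
          ((∏ j, ∏ k ∈ Finset.Ioi j, dist (z j) (z k) : ℝ) : ℂ) * angularPart z ∧
        (angularPart z).im = 0 ∧ 64 ≤ (angularPart z).re := fun z hz =>
    ⟨atiyahDet_planePoint hz.injective, angularBound_of_convexIndependent hz⟩
  refine ⟨fun P hP hc => ?_, plane⟩
  obtain ⟨z, hz, hd, he⟩ := exists_plane_model hP hc
  obtain ⟨h1, h2, h3⟩ := plane z hz
  simp only [hd] at h1
  rw [he, h1, Complex.im_ofReal_mul, Complex.re_ofReal_mul, h2, mul_zero]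
  refine ⟨rfl, ?_⟩
  -- There are six pairs, and `2⁶ = 64` is exactly the bound for the angular part.
  have e : ∏ j : Fin 4, ∏ k ∈ Finset.Ioi j, (2 * dist (P j) (P k)) =
      (∏ j, ∏ k ∈ Finset.Ioi j, dist (P j) (P k)) * 64 := by
    simp_rw [Finset.prod_mul_distrib, Finset.prod_const]
    rw [Fin.prod_univ_four, mul_comm]
    simp [Fin.card_Ioi]
    norm_num
  rw [e]
  exact mul_le_mul_of_nonneg_left h3
    (Finset.prod_nonneg fun j _ => Finset.prod_nonneg fun k _ => dist_nonneg)
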